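/- Let $K$ be a field of characteristic $0$ (for instance $\mathbb R$), let $n\ge 0$, and let $(p_a)_a$ be any family of integers $p_a\ge 1$. For each $a$ and each $0\le l\le \min(p_a,n)$ let $B^{a\,(l,p_a-l)}_{\mu_1\dots\mu_l}$ ($1\le\mu_i\le n$) be antisymmetric components of ghost number $p_a-l$: the gauge field for $l=p_a$, its ghosts and ghosts of ghosts for $l<p_a$, and the last ghost of ghost $C^a_{p_a}=B^{a\,(0,p_a)}$ for $l=0$. Let $\mathcal N$ be the free graded-commutative $K$-algebra generated by the independent components $B^{a\,(l,p_a-l)}_{\mu_1\dots\mu_l}$ and all their formal derivatives $\partial_{\alpha_1}\cdots\partial_{\alpha_k}B^{a\,(l,p_a-l)}_{\mu_1\dots\mu_l}$ (symmetric in the $\alpha$'s), a generator being even or odd according to its ghost number. Let $\mathcal P$ be the free graded-commutative algebra on the same generators together with odd generators $dx^1,\dots,dx^n$; its elements are the local forms with coefficients in $\mathcal N$. Let $\gamma$ be the odd derivation, $\gamma(xy)=(\gamma x)y+(-1)^{\epsilon_x}x\,\gamma y$ with $\epsilon_x$ the Grassmann parity of $x$, which satisfies $\gamma\,dx^\mu=0$,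 commutes with all $\partial_\mu$ on $\mathcal N$, and is given by $$\gamma B^{a\,(l,p_a-l)}_{\mu_1\dots\mu_l}=\partial_{[\mu_1}B^{a\,(l-1,p_a-l+1)}_{\mu_2\dots\mu_l]}\quad(1\le l\le p_a),\qquad \gamma B^{a\,(0,p_a)}=0 .$$ Let $\mathcal I\subset\mathcal N$ be the subalgebra generated by the field-strength components $$H^a_{\mu_1\dots\mu_{p_a+1}}=\sum_i(-1)^{i-1}\partial_{\mu_i}B^{a\,(p_a,0)}_{\mu_1\dots\widehat{\mu_i}\dots\mu_{p_a+1}}$$ and all their derivatives, let $\mathcal C\subset\mathcal N$ be the subalgebra generated by the undifferentiated last ghosts of ghosts $C^a_{p_a}$, and let $\Lambda\subset\mathcal P$ be the subalgebra generated by the $dx^\mu$. Write $H(\gamma,\cdot)=\ker\gamma/\operatorname{im}\gamma$. Then: 1. The elements of $\mathcal I$ and $\mathcal C$ are $\gamma$-closed, and $i\otimes c\mapsto[ic]$ is an isomorphism of $K$-algebras $$\mathcal I\otimes_K\mathcal C\;\cong\;H(\gamma,\mathcal N).$$ 2. In the algebra of local forms, $w\otimes i\otimes c\mapsto[w\,i\,c]$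 is an isomorphism $$\Lambda\otimes_K\mathcal I\otimes_K\mathcal C\;\cong\;H(\gamma,\mathcal P)$$ of $K$-vector spaces, and of algebras for the graded product $(w\otimes i\otimes c)(w'\otimes i'\otimes c')=(-1)^{\epsilon_{w'}\epsilon_c}\,ww'\otimes ii'\otimes cc'$ for $w'$ and $c$ of definite parities $\epsilon_{w'},\epsilon_c$. -/

import Mathlib

namespace PForm

/-! ### Free graded-commutative algebras -/

/-- Graded commutativity of the generators `x`, `y` of degrees `deg x`, `deg y`. For a field of
characteristic zero it includes `x * x = 0` for every generator of odd degree. -/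
inductive SuperRel (K : Type*) [Field K] {X : Type*} (deg : X → ℕ) :
    FreeAlgebra K X → FreeAlgebra K X → Prop
  | comm (x y : X) : SuperRel K deg (FreeAlgebra.ι K x * FreeAlgebra.ι K y)
      (((-1 : K) ^ (deg x * deg y)) • (FreeAlgebra.ι K y * FreeAlgebra.ι K x))

/-- The free graded-commutative unital `K`-algebra on generators `x : X` of Grassmann parity
`deg x` mod 2: polynomials in the even generators and anticommuting odd generators. -/
def SuperPoly (K : Type*) [Field K] {X : Type*} (deg : X → ℕ) : Type _ :=
  RingQuot (SuperRel K deg)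

namespace SuperPoly

noncomputable section

variable {K : Type*} [Field K] {X : Type*} {deg : X → ℕ}

instance : Semiring (SuperPoly K deg) := inferInstanceAs (Semiring (RingQuot _))

instance : Algebra K (SuperPoly K deg) := inferInstanceAs (Algebra K (RingQuot _))

instance : Ring (SuperPoly K deg) := Algebra.semiringToRing K

/-- The quotient map from the free algebra. -/
def mk (K : Type*) [Field K] {X : Type*} (deg : X → ℕ) : FreeAlgebra K X →ₐ[K] SuperPoly K deg :=
  RingQuot.mkAlgHom K (SuperRel K deg)

/-- The generator of `SuperPoly K deg` attached to `x`. -/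
def gen (K : Type*) [Field K] {X : Type*} (deg : X → ℕ) (x : X) : SuperPoly K deg :=
  mk K deg (FreeAlgebra.ι K x)

theorem gen_comm (x y : X) :
    gen K deg x * gen K deg y = ((-1 : K) ^ (deg x * deg y)) • (gen K deg y * gen K deg x) := by
  have h : mk K deg _ = mk K deg _ := RingQuot.mkAlgHom_rel K (SuperRel.comm x y)
  simpa [gen] using h

/-- The universal property: an algebra homomorphism out of `SuperPoly K deg` is given by images of
the generators that commute in the graded sense. -/
def lift {B : Type*} [Semiring B] [Algebra K B] (g : X → B)
    (hg : ∀ x y, g x * g y = ((-1 : K) ^ (deg x * deg y)) • (g y * g x)) :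
    SuperPoly K deg →ₐ[K] B :=
  RingQuot.liftAlgHom K ⟨FreeAlgebra.lift K g, by
    rintro _ _ ⟨x, y⟩
    simpa using hg x y⟩

@[simp] theorem lift_gen {B : Type*} [Semiring B] [Algebra K B] (g : X → B)
    (hg : ∀ x y, g x * g y = ((-1 : K) ^ (deg x * deg y)) • (g y * g x)) (x : X) :
    lift g hg (gen K deg x) = g x := by
  have h : lift g hg (gen K deg x) = FreeAlgebra.lift K g (FreeAlgebra.ι K x) :=
    RingQuot.liftAlgHom_mkAlgHom_apply K _ _ _
  rw [h, FreeAlgebra.lift_ι_apply]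

theorem induction {C : SuperPoly K deg → Prop} (hc : ∀ r : K, C (algebraMap K _ r))
    (hx : ∀ x, C (gen K deg x)) (hmul : ∀ a b, C a → C b → C (a * b))
    (hadd : ∀ a b, C a → C b → C (a + b)) (a : SuperPoly K deg) : C a := by
  have hs : Function.Surjective (mk K deg) := RingQuot.mkAlgHom_surjective K (SuperRel K deg)
  obtain ⟨a, rfl⟩ := hs a
  induction a using FreeAlgebra.induction with
  | grade0 r => simpa using hc r
  | grade1 x => exact hx x
  | mul a b ha hb => simpa using hmul _ _ ha hb
  | add a b ha hb => simpa using hadd _ _ ha hb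

/-- The automorphism multiplying the generator `x` by `(-1) ^ (e * deg x)`: the identity for
`e = 0`, the Grassmann parity automorphism for `e = 1`. -/
def twist (K : Type*) [Field K] {X : Type*} (deg : X → ℕ) (e : ℕ) :
    SuperPoly K deg →ₐ[K] SuperPoly K deg :=
  lift (fun x => ((-1 : K) ^ (e * deg x)) • gen K deg x) fun x y => by
    rw [smul_mul_smul_comm, smul_mul_smul_comm, gen_comm x y, smul_smul, smul_smul]
    congr 1
    ring

@[simp] theorem twist_gen (e : ℕ) (x : X) :
    twist K deg e (gen K deg x) = ((-1 : K) ^ (e * deg x)) • gen K deg x := by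
  simp [twist]

theorem twist_zero (a : SuperPoly K deg) : twist K deg 0 a = a := by
  induction a using induction with
  | hc r => simp
  | hx x => simp
  | hmul a b ha hb => simp [ha, hb]
  | hadd a b ha hb => simp [ha, hb]

theorem twist_twist (e : ℕ) (a : SuperPoly K deg) : twist K deg e (twist K deg e a) = a := by
  induction a using induction with
  | hc r => simp
  | hx x => simp [smul_smul, ← mul_pow]
  | hmul a b ha hb => simp [ha, hb]
  | hadd a b ha hb => simp [ha, hb]

/-- A map `f` from the generators to the algebra raising Grassmann parity by `e`, in the form
needed for it to extend to a derivation: `f x` commutes with generators like an element of degree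
`deg x + e`. -/
def HasShift (e : ℕ) (f : X → SuperPoly K deg) : Prop :=
  ∀ x y, f x * gen K deg y = ((-1 : K) ^ ((deg x + e) * deg y)) • (gen K deg y * f x)

/-- Auxiliary homomorphism `a ↦ !![twist a, D a; 0, a]` that encodes the derivation `D`. -/
def derAux (e : ℕ) (f : X → SuperPoly K deg) (hf : HasShift e f) :
    SuperPoly K deg →ₐ[K] Matrix (Fin 2) (Fin 2) (SuperPoly K deg) :=
  lift (fun x => !![twist K deg e (gen K deg x), f x; 0, gen K deg x]) fun x y => by
    have h1 := gen_comm (K := K) (deg := deg) x y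
    have h2 := hf x y
    have h3 := hf y x
    have sq : ∀ m : ℕ, ((-1 : K) ^ m) * ((-1 : K) ^ m) = 1 := fun m => by
      rw [← mul_pow]; simp
    have h4 : ((-1 : K) ^ (e * deg x)) • (gen K deg x * f y)
        = ((-1 : K) ^ (deg x * deg y)) • (f y * gen K deg x) := by
      rw [h3, smul_smul, ← pow_add,
        show deg x * deg y + (deg y + e) * deg x = e * deg x + (deg x * deg y + deg x * deg y)
          by ring, pow_add, pow_add _ (deg x * deg y), sq, mul_one]
    have h5 : f x * gen K deg y = ((-1 : K) ^ (deg x * deg y)) •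
        (((-1 : K) ^ (e * deg y)) • (gen K deg y * f x)) := by
      rw [h2, smul_smul, ← pow_add, add_mul]
    have h0 : twist K deg e (gen K deg x) * twist K deg e (gen K deg y)
        = ((-1 : K) ^ (deg x * deg y)) •
          (twist K deg e (gen K deg y) * twist K deg e (gen K deg x)) := by
      rw [← map_mul, ← map_mul, h1, map_smul]
    rw [Matrix.mul_fin_two, Matrix.mul_fin_two, Matrix.smul_of]
    ext i j
    fin_cases i <;> fin_cases j
    · simpa using h0
    · simp only [twist_gen, smul_mul_assoc] at *
      simp [h4, h5, add_comm]
    · simp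
    · simpa using h1

theorem derAux_apply (e : ℕ) (f : X → SuperPoly K deg) (hf : HasShift e f) (a : SuperPoly K deg) :
    derAux e f hf a 0 0 = twist K deg e a ∧ derAux e f hf a 1 0 = 0 ∧
      derAux e f hf a 1 1 = a := by
  induction a using induction with
  | hc r => simp [Matrix.algebraMap_matrix_apply]
  | hx x => simp [derAux]
  | hmul a b ha hb => simp [Matrix.mul_apply, ha, hb]
  | hadd a b ha hb => simp [ha, hb]

/-- The derivation `D` with `D (gen x) = f x` and
`D (a * b) = D a * b + (-1) ^ (e * deg a) * a * D b`. -/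
def der (e : ℕ) (f : X → SuperPoly K deg) (hf : HasShift e f) :
    SuperPoly K deg →ₗ[K] SuperPoly K deg where
  toFun a := derAux e f hf a 0 1
  map_add' a b := by simp
  map_smul' r a := by simp

@[simp] theorem der_gen (e : ℕ) (f : X → SuperPoly K deg) (hf : HasShift e f) (x : X) :
    der e f hf (gen K deg x) = f x := by
  simp [der, derAux]

theorem der_mul (e : ℕ) (f : X → SuperPoly K deg) (hf : HasShift e f) (a b : SuperPoly K deg) :
    der e f hf (a * b) = der e f hf a * b + twist K deg e a * der e f hf b := by
  simp [der, Matrix.mul_apply, derAux_apply, add_comm]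

@[simp] theorem der_algebraMap (e : ℕ) (f : X → SuperPoly K deg) (hf : HasShift e f) (r : K) :
    der e f hf (algebraMap K _ r) = 0 := by
  simp [der, Matrix.algebraMap_matrix_apply]

theorem der_twist (f : X → SuperPoly K deg) (hf : HasShift 1 f)
    (h : ∀ x, twist K deg 1 (f x) = ((-1 : K) ^ (deg x + 1)) • f x) (a : SuperPoly K deg) :
    der 1 f hf (twist K deg 1 a) = -twist K deg 1 (der 1 f hf a) := by
  induction a using induction with
  | hc r => simp
  | hx x => simp [h, pow_succ]
  | hmul a b ha hb => simp [der_mul, ha, hb]; abel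
  | hadd a b ha hb => simp [ha, hb]; abel

theorem der_der (f : X → SuperPoly K deg) (hf : HasShift 1 f)
    (h : ∀ x, twist K deg 1 (f x) = ((-1 : K) ^ (deg x + 1)) • f x)
    (h' : ∀ x, der 1 f hf (f x) = 0) (a : SuperPoly K deg) :
    der 1 f hf (der 1 f hf a) = 0 := by
  induction a using induction with
  | hc r => simp
  | hx x => simp [h']
  | hmul a b ha hb => simp [der_mul, ha, hb, der_twist f hf h, twist_twist]
  | hadd a b ha hb => simp [ha, hb]

end

end SuperPoly

/-! ### Cohomology algebra of an odd differential -/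

/-- An odd differential `d` on an algebra `A` whose Grassmann parity is recorded by the involutive
automorphism `σ` (`σ a = a` on even, `σ a = -a` on odd elements). -/
structure OddDifferential (K A : Type*) [Field K] [Ring A] [Algebra K A] where
  σ : A →ₐ[K] A
  d : A →ₗ[K] A
  σ_σ : ∀ a, σ (σ a) = a
  leibniz : ∀ a b, d (a * b) = d a * b + σ a * d b
  d_σ : ∀ a, d (σ a) = -σ (d a)
  d_d : ∀ a, d (d a) = 0

namespace OddDifferential

variable {K A : Type*} [Field K] [Ring A] [Algebra K A] (D : OddDifferential K A)

/-- The subalgebra `ker d` of cocycles. -/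
def cocycles : Subalgebra K A where
  carrier := {a | D.d a = 0}
  mul_mem' {a b} ha hb := by
    simp only [Set.mem_ofPred_eq] at *
    simp [D.leibniz, ha, hb]
  add_mem' {a b} ha hb := by
    simp only [Set.mem_ofPred_eq] at *
    simp [ha, hb]
  algebraMap_mem' r := by
    have h1 : D.d 1 = 0 := by simpa using D.leibniz 1 1
    simp [Algebra.algebraMap_eq_smul_one, h1]

theorem mem_cocycles {a : A} : a ∈ D.cocycles ↔ D.d a = 0 := Iff.rfl

/-- The ideal `im d` of coboundaries inside `ker d`. -/
def coboundaries : Ideal D.cocycles where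
  carrier := {z | ∃ b, D.d b = z}
  add_mem' := by
    rintro _ _ ⟨b, hb⟩ ⟨c, hc⟩
    exact ⟨b + c, by simp [hb, hc]⟩
  zero_mem' := ⟨0, by simp⟩
  smul_mem' := by
    rintro ⟨z, hz⟩ _ ⟨b, hb⟩
    refine ⟨D.σ z * b, ?_⟩
    rw [mem_cocycles] at hz
    simp [D.leibniz, D.d_σ, D.σ_σ, hz, hb]

instance : D.coboundaries.IsTwoSided where
  mul_mem_of_left {a} b := by
    rintro ⟨c, hc⟩
    refine ⟨c * b, ?_⟩
    have hb := D.mem_cocycles.1 b.2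
    simp [D.leibniz, hb, hc]

/-- The cohomology algebra `H(d) = ker d / im d`. -/
abbrev Cohomology : Type _ := D.cocycles ⧸ D.coboundaries

/-- The cohomology class of a cocycle. -/
def cls (a : A) (ha : D.d a = 0) : D.Cohomology :=
  Ideal.Quotient.mk D.coboundaries ⟨a, ha⟩

end OddDifferential

/-! ### Fields, ghosts and their derivatives -/

/-- Generators of the local functions. For `α` a multi-index and `s = {μ₁ < ... < μ_l}` a set of
spacetime indices, `⟨a, α, s, _⟩` is the derivative `∂_α B^{a (l, p_a - l)}_{μ₁ ... μ_l}`: it comes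
from the gauge field `B^a` itself for `l = p_a`, from its ghosts for `l < p_a`, and from the last
ghost of ghost for `l = 0`. The components with indices in another order are those of `s` up to the
sign of the permutation, and components with a repeated index vanish. -/
structure Jet (n : ℕ) {ι : Type*} (p : ι → ℕ) where
  a : ι
  α : Fin n →₀ ℕ
  s : Finset (Fin n)
  card_le : s.card ≤ p a

namespace Jet

variable {n : ℕ} {ι : Type*} {p : ι → ℕ}

/-- The ghost number of `∂_α B^{a (l, p_a - l)}`; modulo 2 it is the Grassmann parity. -/
def ghost (j : Jet n p) : ℕ := p j.a - j.s.card

/-- `∂_μ ∂_α B^{a}_s`, as a generator. -/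
noncomputable def shift (μ : Fin n) (j : Jet n p) : Jet n p :=
  ⟨j.a, j.α + Finsupp.single μ 1, j.s, j.card_le⟩

/-- `∂_μ ∂_α B^{a}_{s \ μ}`, as a generator. -/
noncomputable def remove (μ : Fin n) (j : Jet n p) : Jet n p :=
  ⟨j.a, j.α + Finsupp.single μ 1, j.s.erase μ, (Finset.card_erase_le).trans j.card_le⟩

theorem ghost_remove {μ : Fin n} {j : Jet n p} (h : μ ∈ j.s) :
    (j.remove μ).ghost = j.ghost + 1 := by
  have h1 := Finset.card_erase_add_one h
  have h2 := j.card_le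
  simp only [ghost, remove]
  omega

end Jet

/-- The sign `(-1)^{i-1}` of the index `μ = μ_i` in `s = {μ₁ < ... < μ_l}`. -/
def posSign (K : Type*) [Field K] {n : ℕ} (s : Finset (Fin n)) (μ : Fin n) : K :=
  (-1) ^ (s.filter (· < μ)).card

noncomputable section

variable (K : Type*) [Field K] {n : ℕ} {ι : Type*} (p : ι → ℕ)

/-- The algebra of local functions: polynomials in the components of the fields, ghosts, ghosts of
ghosts and their derivatives. -/
abbrev LocalFun (n : ℕ) {ι : Type*} (p : ι → ℕ) : Type _ :=
  SuperPoly K (Jet.ghost : Jet n p → ℕ)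

variable {p}

/-- The variable `∂_α B^a_s` as a local function. -/
def jet (j : Jet n p) : LocalFun K n p := SuperPoly.gen K Jet.ghost j

theorem hasShift_shift (μ : Fin n) :
    SuperPoly.HasShift 0 fun j : Jet n p => jet K (j.shift μ) := fun x y =>
  SuperPoly.gen_comm (x.shift μ) y

/-- The total derivative `∂_μ` on local functions. -/
def totalDer (μ : Fin n) : LocalFun K n p →ₗ[K] LocalFun K n p :=
  SuperPoly.der 0 (fun j => jet K (j.shift μ)) (hasShift_shift K μ)

/-- The value of `γ` on the generators: for `s = {μ₁ < ... < μ_l}`,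
`γ ∂_α B_{μ₁ ... μ_l} = ∂_α ∂_{[μ₁} B_{μ₂ ... μ_l]}
  = (1/l) ∑_i (-1)^{i-1} ∂_α ∂_{μ_i} B_{μ₁ .. μ_{i-1} μ_{i+1} .. μ_l}`,
and `0` for `s = ∅`. -/
def gammaGen (j : Jet n p) : LocalFun K n p :=
  (j.s.card : K)⁻¹ • ∑ μ ∈ j.s, posSign K j.s μ • jet K (j.remove μ)

theorem hasShift_gammaGen : SuperPoly.HasShift 1 (gammaGen K : Jet n p → LocalFun K n p) := by
  intro x y
  simp only [gammaGen, smul_mul_assoc, mul_smul_comm, Finset.sum_mul, Finset.mul_sum]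
  simp only [Finset.smul_sum]
  refine Finset.sum_congr rfl fun μ hμ => ?_
  have h := SuperPoly.gen_comm (K := K) (deg := Jet.ghost) (x.remove μ) y
  rw [Jet.ghost_remove hμ] at h
  rw [jet, h]
  simp only [smul_smul]
  congr 1
  ring

/-- The BRST differential `γ` on local functions. -/
def gammaFun : LocalFun K n p →ₗ[K] LocalFun K n p :=
  SuperPoly.der 1 (gammaGen K) (hasShift_gammaGen K)

theorem gammaFun_jet (j : Jet n p) : gammaFun K (jet K j) = gammaGen K j :=
  SuperPoly.der_gen 1 (gammaGen K) (hasShift_gammaGen K) j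

theorem totalDer_jet (μ : Fin n) (j : Jet n p) : totalDer K μ (jet K j) = jet K (j.shift μ) :=
  SuperPoly.der_gen 0 (fun j => jet K (j.shift μ)) (hasShift_shift K μ) j

theorem totalDer_mul (μ : Fin n) (a b : LocalFun K n p) :
    totalDer K μ (a * b) = totalDer K μ a * b + a * totalDer K μ b := by
  have h := SuperPoly.der_mul 0 (fun j => jet K (j.shift μ)) (hasShift_shift K μ) a b
  rwa [SuperPoly.twist_zero] at h

theorem gammaFun_mul (a b : LocalFun K n p) :
    gammaFun K (a * b) = gammaFun K a * b + SuperPoly.twist K Jet.ghost 1 a * gammaFun K b :=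
  SuperPoly.der_mul 1 (gammaGen K) (hasShift_gammaGen K) a b

theorem twist_gammaGen (j : Jet n p) :
    SuperPoly.twist K Jet.ghost 1 (gammaGen K j) = ((-1 : K) ^ (j.ghost + 1)) • gammaGen K j := by
  simp only [gammaGen, map_smul, map_sum]
  simp only [Finset.smul_sum]
  refine Finset.sum_congr rfl fun μ hμ => ?_
  rw [jet, SuperPoly.twist_gen, Jet.ghost_remove hμ, one_mul]
  simp only [smul_smul]
  congr 1
  ring

theorem posSign_erase {s : Finset (Fin n)} {μ ν : Fin n} (hμ : μ ∈ s) (hν : ν ∈ s) (h : μ ≠ ν) :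
    posSign K s μ * posSign K (s.erase μ) ν = -(posSign K s ν * posSign K (s.erase ν) μ) := by
  wlog hlt : μ < ν generalizing μ ν
  · have := this hν hμ h.symm (lt_of_le_of_ne (not_lt.1 hlt) h.symm)
    rw [this, neg_neg]
  have h1 : ((s.erase μ).filter (· < ν)) = (s.filter (· < ν)).erase μ := by
    ext x; simp [and_assoc]
  have h2 : ((s.erase ν).filter (· < μ)) = s.filter (· < μ) := by
    ext x
    simp only [Finset.mem_filter, Finset.mem_erase]
    constructor
    · rintro ⟨⟨_, h⟩, h'⟩; exact ⟨h, h'⟩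
    · rintro ⟨h, h'⟩; exact ⟨⟨(h'.trans hlt).ne, h⟩, h'⟩
  have h3 : μ ∈ s.filter (· < ν) := by simp [hμ, hlt]
  have h4 := Finset.card_erase_add_one h3
  simp only [posSign, h1, h2]
  rw [← h4, pow_succ]
  ring

theorem gammaFun_gammaGen (j : Jet n p) : gammaFun K (gammaGen K j) = 0 := by
  have key : ∀ μ ∈ j.s, posSign K j.s μ • gammaFun K (jet K (j.remove μ))
      = ((j.s.card - 1 : ℕ) : K)⁻¹ • ∑ ν ∈ j.s.erase μ,
        (posSign K j.s μ * posSign K (j.s.erase μ) ν) • jet K ((j.remove μ).remove ν) := by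
    intro μ hμ
    rw [gammaFun_jet, gammaGen, smul_comm, Finset.smul_sum]
    simp only [Jet.remove, Finset.card_erase_of_mem hμ, smul_smul]
  simp only [gammaGen, map_smul, map_sum]
  rw [Finset.sum_congr rfl key, ← Finset.smul_sum, Finset.sum_sigma']
  suffices h : ∑ x ∈ j.s.sigma (fun μ => j.s.erase μ),
      (posSign K j.s x.1 * posSign K (j.s.erase x.1) x.2) •
        jet K ((j.remove x.1).remove x.2) = 0 by
    rw [h, smul_zero, smul_zero]
  refine Finset.sum_involution (fun x _ => ⟨x.2, x.1⟩) ?_ ?_ ?_ ?_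
  · rintro ⟨μ, ν⟩ hx
    simp only [Finset.mem_sigma, Finset.mem_erase] at hx
    have e : (j.remove ν).remove μ = (j.remove μ).remove ν := by
      simp only [Jet.remove, Jet.mk.injEq, true_and]
      exact ⟨add_right_comm _ _ _, Finset.erase_right_comm⟩
    simp only [e]
    rw [← add_smul, posSign_erase K hx.1 hx.2.2 hx.2.1.symm, neg_add_cancel, zero_smul]
  · rintro ⟨μ, ν⟩ hx _ h
    simp only [Finset.mem_sigma, Finset.mem_erase] at hx
    simp only [Sigma.mk.injEq] at h
    exact hx.2.1 h.1
  · rintro ⟨μ, ν⟩ hx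
    simp only [Finset.mem_sigma, Finset.mem_erase] at hx ⊢
    exact ⟨hx.2.2, hx.2.1.symm, hx.1⟩
  · rintro ⟨μ, ν⟩ hx
    rfl

/-- `γ` commutes with the total derivatives; hence it is the extension to differentiated
generators of its value on undifferentiated ones. -/
theorem gammaFun_totalDer (μ : Fin n) (f : LocalFun K n p) :
    gammaFun K (totalDer K μ f) = totalDer K μ (gammaFun K f) := by
  have ht : ∀ b : LocalFun K n p, totalDer K μ (SuperPoly.twist K Jet.ghost 1 b)
      = SuperPoly.twist K Jet.ghost 1 (totalDer K μ b) := by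
    intro b
    induction b using SuperPoly.induction with
    | hc r => simp [totalDer]
    | hx x =>
      rw [SuperPoly.twist_gen, map_smul, ← jet, totalDer_jet, jet, SuperPoly.twist_gen]
      rfl
    | hmul a b ha hb =>
      simp only [totalDer] at ha hb
      simp [totalDer, SuperPoly.der_mul, SuperPoly.twist_zero, ha, hb]
    | hadd a b ha hb => simp [ha, hb]
  induction f using SuperPoly.induction with
  | hc r => simp [totalDer, gammaFun]
  | hx x =>
    change gammaFun K (totalDer K μ (jet K x)) = totalDer K μ (gammaFun K (jet K x))
    rw [totalDer_jet, gammaFun_jet, gammaFun_jet, gammaGen, gammaGen]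
    simp only [map_smul, map_sum, totalDer_jet]
    congr 1
    refine Finset.sum_congr rfl fun ν _ => ?_
    simp only [Jet.remove, Jet.shift, add_right_comm]
  | hmul a b ha hb =>
    have h1 := totalDer_mul K (p := p) μ
    have h2 := gammaFun_mul K (n := n) (p := p)
    simp only [h1, h2, map_add, ha, hb, ht]
    abel
  | hadd a b ha hb => simp [ha, hb]

/-- The differential algebra of local functions with `γ`. -/
def funComplex (n : ℕ) {ι : Type*} (p : ι → ℕ) : OddDifferential K (LocalFun K n p) where
  σ := SuperPoly.twist K Jet.ghost 1
  d := gammaFun K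
  σ_σ := SuperPoly.twist_twist 1
  leibniz := SuperPoly.der_mul 1 _ _
  d_σ := SuperPoly.der_twist _ _ (twist_gammaGen K)
  d_d := SuperPoly.der_der _ _ (twist_gammaGen K) (gammaFun_gammaGen K)

/-! ### Local forms -/

/-- Grassmann parity of the generators of the local forms: the differentials `dx^μ` are odd, the
parity of the fields and ghosts is their ghost number. -/
def formDeg : Fin n ⊕ Jet n p → ℕ := Sum.elim (fun _ => 1) Jet.ghost

/-- The algebra of spacetime forms whose coefficients are local functions, without explicit
dependence on the coordinates. -/
abbrev LocalForm (n : ℕ) {ι : Type*} (p : ι → ℕ) : Type _ :=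
  SuperPoly K (formDeg : Fin n ⊕ Jet n p → ℕ)

/-- The one-form `dx^μ`. -/
def dx (p : ι → ℕ) (μ : Fin n) : LocalForm K n p := SuperPoly.gen K formDeg (Sum.inl μ)

/-- Local functions as local forms of form degree `0`. -/
def toForm : LocalFun K n p →ₐ[K] LocalForm K n p :=
  SuperPoly.lift (fun j => SuperPoly.gen K formDeg (Sum.inr j)) fun x y =>
    SuperPoly.gen_comm (Sum.inr x) (Sum.inr y)

theorem toForm_jet (j : Jet n p) : toForm K (jet K j) = SuperPoly.gen K formDeg (Sum.inr j) := by
  exact SuperPoly.lift_gen (deg := Jet.ghost) (fun j => SuperPoly.gen K formDeg (Sum.inr j))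
    (fun x y => SuperPoly.gen_comm (Sum.inr x) (Sum.inr y)) j

/-- The value of `γ` on the generators of the local forms: `γ dx^μ = 0`, and as before on fields
and ghosts. -/
def gammaFormGen : Fin n ⊕ Jet n p → LocalForm K n p :=
  Sum.elim (fun _ => 0) fun j => toForm K (gammaGen K j)

theorem hasShift_gammaFormGen :
    SuperPoly.HasShift 1 (gammaFormGen K : Fin n ⊕ Jet n p → LocalForm K n p) := by
  rintro (x | x) y
  · simp [gammaFormGen]
  simp only [gammaFormGen, Sum.elim_inr, gammaGen, map_smul, map_sum, toForm_jet,
    smul_mul_assoc, mul_smul_comm, Finset.sum_mul, Finset.mul_sum]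
  simp only [Finset.smul_sum]
  refine Finset.sum_congr rfl fun μ hμ => ?_
  have h := SuperPoly.gen_comm (K := K) (deg := formDeg) (Sum.inr (x.remove μ)) y
  have hd : formDeg (Sum.inr (x.remove μ) : Fin n ⊕ Jet n p) = formDeg (Sum.inr x) + 1 :=
    Jet.ghost_remove hμ
  rw [h, hd]
  simp only [smul_smul]
  congr 1
  ring

/-- The BRST differential `γ` on local forms. -/
def gamma : LocalForm K n p →ₗ[K] LocalForm K n p :=
  SuperPoly.der 1 (gammaFormGen K) (hasShift_gammaFormGen K)

theorem twist_toForm (f : LocalFun K n p) :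
    SuperPoly.twist K formDeg 1 (toForm K f) = toForm K (SuperPoly.twist K Jet.ghost 1 f) := by
  induction f using SuperPoly.induction with
  | hc r => simp
  | hx x =>
    rw [SuperPoly.twist_gen, map_smul, ← jet, toForm_jet, SuperPoly.twist_gen]
    rfl
  | hmul a b ha hb => simp [ha, hb]
  | hadd a b ha hb => simp [ha, hb]

theorem gamma_toForm (f : LocalFun K n p) : gamma K (toForm K f) = toForm K (gammaFun K f) := by
  induction f using SuperPoly.induction with
  | hc r => simp [gamma, gammaFun]
  | hx x =>
    change gamma K (toForm K (jet K x)) = toForm K (gammaFun K (jet K x))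
    rw [gammaFun_jet, toForm_jet, gamma, SuperPoly.der_gen]
    rfl
  | hmul a b ha hb =>
    have h1 : ∀ a b : LocalForm K n p, gamma K (a * b)
        = gamma K a * b + SuperPoly.twist K formDeg 1 a * gamma K b :=
      SuperPoly.der_mul 1 (gammaFormGen K) (hasShift_gammaFormGen K)
    have h2 := gammaFun_mul K (n := n) (p := p)
    simp only [h1, h2, map_mul, map_add, ha, hb, twist_toForm]
  | hadd a b ha hb => simp [ha, hb]

theorem twist_gammaFormGen (x : Fin n ⊕ Jet n p) :
    SuperPoly.twist K formDeg 1 (gammaFormGen K x)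
      = ((-1 : K) ^ (formDeg x + 1)) • gammaFormGen K x := by
  rcases x with x | x
  · simp [gammaFormGen]
  · simp only [gammaFormGen, Sum.elim_inr, twist_toForm, twist_gammaGen, map_smul]
    rfl

theorem gamma_gammaFormGen (x : Fin n ⊕ Jet n p) : gamma K (gammaFormGen K x) = 0 := by
  rcases x with x | x
  · simp [gammaFormGen]
  · simp only [gammaFormGen, Sum.elim_inr, gamma_toForm, gammaFun_gammaGen, map_zero]

/-- The differential algebra of local forms with `γ`. -/
def formComplex (n : ℕ) {ι : Type*} (p : ι → ℕ) : OddDifferential K (LocalForm K n p) where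
  σ := SuperPoly.twist K formDeg 1
  d := gamma K
  σ_σ := SuperPoly.twist_twist 1
  leibniz := SuperPoly.der_mul 1 _ _
  d_σ := SuperPoly.der_twist _ _ (twist_gammaFormGen K)
  d_d := SuperPoly.der_der _ _ (twist_gammaFormGen K) (gamma_gammaFormGen K)

/-! ### The algebras of curvatures and of last ghosts of ghosts -/

/-- The component `H^a_{μ₁ ... μ_{p_a+1}} = ∑_i (-1)^{i-1} ∂_{μ_i} B^a_{μ₁ .. μ̂_i .. μ_{p_a+1}}` of
the field strength `H^a = dB^a`, where `s = {μ₁ < ... < μ_{p_a+1}}`. -/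
def fieldStrength (a : ι) (s : Finset (Fin n)) (hs : s.card = p a + 1) : LocalFun K n p :=
  ∑ μ ∈ s.attach, posSign K s μ.1 • totalDer K μ.1
    (jet K ⟨a, 0, s.erase μ.1, by rw [Finset.card_erase_of_mem μ.2, hs]; simp⟩)

/-- The last ghost of ghost `C^a_{p_a} = B^{a (0, p_a)}`, undifferentiated. -/
def lastGhost (n : ℕ) {ι : Type*} (p : ι → ℕ) (a : ι) : LocalFun K n p :=
  jet K ⟨a, 0, ∅, by simp⟩

/-- The algebra generated by the components of the field strengths and all their derivatives
`∂_{ν₁} ... ∂_{ν_k} H^a_{μ₁ ... μ_{p_a+1}}`. -/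
def curvatureAlg (n : ℕ) {ι : Type*} (p : ι → ℕ) : Subalgebra K (LocalFun K n p) :=
  Algebra.adjoin K {f | ∃ (a : ι) (s : Finset (Fin n)) (hs : s.card = p a + 1)
    (ν : List (Fin n)), f = ν.foldr (fun μ g => totalDer K μ g) (fieldStrength K a s hs)}

/-- The algebra generated by the undifferentiated last ghosts of ghosts. -/
def lastGhostAlg (n : ℕ) {ι : Type*} (p : ι → ℕ) : Subalgebra K (LocalFun K n p) :=
  Algebra.adjoin K (Set.range (lastGhost K n p))

/-- The algebra of constant forms, generated by the `dx^μ`. -/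
def constFormAlg (n : ℕ) {ι : Type*} (p : ι → ℕ) : Subalgebra K (LocalForm K n p) :=
  Algebra.adjoin K (Set.range (dx K p))

end

end PForm

open scoped TensorProduct

/-!
In the linear span of the jet variables, `γ` is the Koszul differential
`Sym^k ⊗ Λ^l → Sym^{k+1} ⊗ Λ^{l-1}`, truncated to `l ≤ p a`. Contraction with the Euler vector
field, suitably normalized, is a contracting homotopy of the Koszul complex (`koszul_homotopy`).
The truncation spoils it only on the gauge fields `l = p a`, where the missing term is a combination
of derivatives of field strengths. Hence the cohomology of the span is spanned by these and by
the undifferentiated last ghosts of ghosts (`jet_sub_laplacian_mem`).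

The homotopy extends to an odd derivation `ρ` of the local functions, and `L = γ ρ + ρ γ` is an even
derivation that commutes with `γ`. Its eigenvectors multiply, with eigenvalues adding up, so the
whole algebra is the sum of the subalgebra `S` generated by curvatures and last ghosts of ghosts
(eigenvalue `0`) and of eigenspaces for positive integers (`SuperPoly.exists_add_positivePart`). In
characteristic zero `L` is invertible on the latter, so they carry no cohomology, while `γ` vanishes
on `S`: thus `ker γ = S ⊕ im γ` (`SuperPoly.exists_add_der_eq`, `SuperPoly.eq_zero_of_eq_der`).
For `1 ≤ p a` the curvatures and the last ghosts of ghosts involve disjoint sets of generators, so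
that `S` is the tensor product of the two subalgebras (`mulHom_injective`).

The local forms are `Λ ⊗ N`, with `Λ` the constant forms and `N` the local functions
(`formMul_surjective`, `formMul_injective`). There `γ` becomes `σ ⊗ γ`, with `σ` the parity
involution (`gamma_formMul`), and flatness of `Λ` over the field gives the cohomology from that
of `N`. The sign in the product comes from moving constant forms through last ghosts of ghosts;
the curvatures are even and hence central (`mul_toForm_mul_mul_toForm`).
-/

namespace PForm

/-! ### Signs in free graded-commutative algebras -/

namespace SuperPoly

noncomputable section

variable {K : Type*} [Field K] {X : Type*} {deg : X → ℕ}

theorem gen_mul (y : X) (a : SuperPoly K deg) :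
    gen K deg y * a = twist K deg (deg y) a * gen K deg y := by
  induction a using induction with
  | hc r => simp [Algebra.commutes]
  | hx x => rw [twist_gen, gen_comm, smul_mul_assoc]
  | hmul a b ha hb => rw [← mul_assoc, ha, mul_assoc, hb, map_mul, mul_assoc]
  | hadd a b ha hb => rw [mul_add, ha, hb, map_add, add_mul]

theorem twist_add (e e' : ℕ) (a : SuperPoly K deg) :
    twist K deg (e + e') a = twist K deg e (twist K deg e' a) := by
  induction a using induction with
  | hc r => simp
  | hx x =>
    rw [twist_gen, twist_gen, map_smul, twist_gen, smul_smul, add_mul, pow_add, mul_comm]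
  | hmul a b ha hb => simp [ha, hb]
  | hadd a b ha hb => simp [ha, hb]

theorem twist_of_parity {a : SuperPoly K deg} {q : ℕ}
    (ha : twist K deg 1 a = ((-1 : K) ^ q) • a) (e : ℕ) :
    twist K deg e a = ((-1 : K) ^ (e * q)) • a := by
  induction e with
  | zero => simp [twist_zero]
  | succ e ih => rw [add_comm, twist_add, ih, map_smul, ha, smul_smul, add_mul, one_mul, pow_add,
      mul_comm]

/-- Moving an element of parity `q` to the left through an arbitrary element. -/
theorem mul_of_parity {a : SuperPoly K deg} {q : ℕ}
    (ha : twist K deg 1 a = ((-1 : K) ^ q) • a) (b : SuperPoly K deg) :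
    b * a = a * twist K deg q b := by
  induction b using induction with
  | hc r => simp [Algebra.commutes]
  | hx y => rw [gen_mul, twist_of_parity ha, twist_gen, mul_smul_comm, smul_mul_assoc, mul_comm q]
  | hmul b c hb hc => rw [mul_assoc, hc, ← mul_assoc, hb, mul_assoc, map_mul]
  | hadd b c hb hc => rw [add_mul, hb, hc, map_add, mul_add]

theorem commute_of_even {a : SuperPoly K deg} (ha : twist K deg 1 a = a)
    (b : SuperPoly K deg) : Commute a b := by
  have h := mul_of_parity (q := 0) (by simpa using ha) b
  rw [twist_zero] at h
  exact h.symm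

/-- The kernel of a derivation of parity `e`, a subalgebra. -/
def derKer (e : ℕ) (f : X → SuperPoly K deg) (hf : HasShift e f) :
    Subalgebra K (SuperPoly K deg) where
  carrier := {a | der e f hf a = 0}
  mul_mem' {a b} ha hb := by
    simp only [Set.mem_ofPred_eq] at *
    simp [der_mul, ha, hb]
  add_mem' {a b} ha hb := by
    simp only [Set.mem_ofPred_eq] at *
    simp [ha, hb]
  algebraMap_mem' r := der_algebraMap e f hf r

theorem mem_derKer {e : ℕ} {f : X → SuperPoly K deg} {hf : HasShift e f} {a : SuperPoly K deg} :
    a ∈ derKer e f hf ↔ der e f hf a = 0 := Iff.rfl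

/-! ### Contracting homotopies of free differential graded-commutative algebras -/

/-- The anticommutator `d r + r d` of the odd derivations `d`, `r` with values `f`, `g` on the
generators. -/
def laplacian (f g : X → SuperPoly K deg) (hf : HasShift 1 f) (hg : HasShift 1 g) :
    Module.End K (SuperPoly K deg) :=
  der 1 f hf ∘ₗ der 1 g hg + der 1 g hg ∘ₗ der 1 f hf

section Laplacian

variable {f g : X → SuperPoly K deg} {hf : HasShift 1 f} {hg : HasShift 1 g}

theorem laplacian_apply (a : SuperPoly K deg) : laplacian f g hf hg a =
    der 1 f hf (der 1 g hg a) + der 1 g hg (der 1 f hf a) := rfl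

/-- The anticommutator of two odd derivations is an even derivation. -/
theorem laplacian_mul (hf' : ∀ x, twist K deg 1 (f x) = ((-1 : K) ^ (deg x + 1)) • f x)
    (hg' : ∀ x, twist K deg 1 (g x) = ((-1 : K) ^ (deg x + 1)) • g x) (a b : SuperPoly K deg) :
    laplacian f g hf hg (a * b) = laplacian f g hf hg a * b + a * laplacian f g hf hg b := by
  simp only [laplacian_apply, der_mul, map_add, der_twist f hf hf', der_twist g hg hg',
    twist_twist, add_mul, mul_add, neg_mul]
  abel

/-- The sum of the eigenspaces of the anticommutator for positive integer eigenvalues. -/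
def positivePart (f g : X → SuperPoly K deg) (hf : HasShift 1 f) (hg : HasShift 1 g) :
    Submodule K (SuperPoly K deg) :=
  ⨆ k : ℕ, (laplacian f g hf hg).eigenspace ((k + 1 : ℕ) : K)

theorem mul_mem_eigenspace (hf' : ∀ x, twist K deg 1 (f x) = ((-1 : K) ^ (deg x + 1)) • f x)
    (hg' : ∀ x, twist K deg 1 (g x) = ((-1 : K) ^ (deg x + 1)) • g x) {a b : SuperPoly K deg}
    {k l : K} (ha : a ∈ (laplacian f g hf hg).eigenspace k)
    (hb : b ∈ (laplacian f g hf hg).eigenspace l) :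
    a * b ∈ (laplacian f g hf hg).eigenspace (k + l) := by
  rw [Module.End.mem_eigenspace_iff] at *
  rw [laplacian_mul hf' hg', ha, hb, smul_mul_assoc, mul_smul_comm, add_smul]

theorem mem_positivePart_of_mem_eigenspace {a : SuperPoly K deg} (k : ℕ)
    (h : a ∈ (laplacian f g hf hg).eigenspace ((k + 1 : ℕ) : K)) :
    a ∈ positivePart f g hf hg :=
  Submodule.mem_iSup_of_mem (p := fun k : ℕ => (laplacian f g hf hg).eigenspace ((k + 1 : ℕ) : K))
    k h

theorem positivePart_mul_eigenspace_le
    (hf' : ∀ x, twist K deg 1 (f x) = ((-1 : K) ^ (deg x + 1)) • f x)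
    (hg' : ∀ x, twist K deg 1 (g x) = ((-1 : K) ^ (deg x + 1)) • g x) (l : ℕ) :
    positivePart f g hf hg * (laplacian f g hf hg).eigenspace (l : K) ≤ positivePart f g hf hg := by
  rw [positivePart, Submodule.iSup_mul]
  refine iSup_le fun k => Submodule.mul_le.2 fun a ha b hb => ?_
  refine mem_positivePart_of_mem_eigenspace (k + l) ?_
  have h := mul_mem_eigenspace hf' hg' ha hb
  rwa [← Nat.cast_add, show k + 1 + l = k + l + 1 by ring] at h

theorem eigenspace_zero_mul_positivePart_le
    (hf' : ∀ x, twist K deg 1 (f x) = ((-1 : K) ^ (deg x + 1)) • f x)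
    (hg' : ∀ x, twist K deg 1 (g x) = ((-1 : K) ^ (deg x + 1)) • g x) :
    (laplacian f g hf hg).eigenspace 0 * positivePart f g hf hg ≤ positivePart f g hf hg := by
  rw [positivePart, Submodule.mul_iSup]
  refine iSup_le fun k => Submodule.mul_le.2 fun a ha b hb => ?_
  refine mem_positivePart_of_mem_eigenspace k ?_
  have h := mul_mem_eigenspace hf' hg' ha hb
  rwa [zero_add] at h

theorem positivePart_mul_self_le
    (hf' : ∀ x, twist K deg 1 (f x) = ((-1 : K) ^ (deg x + 1)) • f x)
    (hg' : ∀ x, twist K deg 1 (g x) = ((-1 : K) ^ (deg x + 1)) • g x) :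
    positivePart f g hf hg * positivePart f g hf hg ≤ positivePart f g hf hg := by
  nth_rw 2 [positivePart]
  rw [Submodule.mul_iSup]
  exact iSup_le fun k => positivePart_mul_eigenspace_le hf' hg' (k + 1)

theorem disjoint_eigenspace_zero_positivePart [CharZero K] :
    Disjoint ((laplacian f g hf hg).eigenspace 0) (positivePart f g hf hg) := by
  refine (Module.End.eigenspaces_iSupIndep (laplacian f g hf hg) 0).mono_right ?_
  refine iSup_le fun k => ?_
  exact le_iSup₂_of_le ((k + 1 : ℕ) : K) (Nat.cast_ne_zero.2 k.succ_ne_zero) le_rfl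

theorem laplacian_der (hdd : ∀ a, der 1 f hf (der 1 f hf a) = 0) (a : SuperPoly K deg) :
    laplacian f g hf hg (der 1 f hf a) = der 1 f hf (laplacian f g hf hg a) := by
  simp [laplacian_apply, hdd]

theorem der_mem_positivePart (hdd : ∀ a, der 1 f hf (der 1 f hf a) = 0) {a : SuperPoly K deg}
    (ha : a ∈ positivePart f g hf hg) : der 1 f hf a ∈ positivePart f g hf hg := by
  revert a
  change positivePart f g hf hg ≤ (positivePart f g hf hg).comap (der 1 f hf)
  refine iSup_le fun k a ha => mem_positivePart_of_mem_eigenspace k ?_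
  rw [Module.End.mem_eigenspace_iff] at *
  rw [laplacian_der hdd, ha, map_smul]

theorem exists_laplacian_eq [CharZero K] {a : SuperPoly K deg}
    (ha : a ∈ positivePart f g hf hg) :
    ∃ u ∈ positivePart f g hf hg, laplacian f g hf hg u = a := by
  revert a
  change positivePart f g hf hg ≤ (positivePart f g hf hg).map (laplacian f g hf hg)
  refine iSup_le fun k a ha => ⟨((k + 1 : ℕ) : K)⁻¹ • a,
    Submodule.smul_mem _ _ (mem_positivePart_of_mem_eigenspace k ha), ?_⟩
  rw [map_smul, Module.End.mem_eigenspace_iff.1 ha, smul_smul,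
    inv_mul_cancel₀ (Nat.cast_ne_zero.2 k.succ_ne_zero), one_smul]

theorem laplacian_eq_zero {S : Subalgebra K (SuperPoly K deg)} (hSf : S ≤ derKer 1 f hf)
    (hSg : S ≤ derKer 1 g hg) {s : SuperPoly K deg} (hs : s ∈ S) : laplacian f g hf hg s = 0 := by
  rw [laplacian_apply, mem_derKer.1 (hSf hs), mem_derKer.1 (hSg hs), map_zero, map_zero, add_zero]

/-- If the anticommutator `L` of two odd derivations acts on each generator as a projection whose
complement takes values in a subalgebra `S` killed by both derivations, then the whole algebra is
the sum of `S` and of the positive eigenspaces of `L`: the generators decompose, and products of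
eigenvectors are eigenvectors. -/
theorem exists_add_positivePart (hf' : ∀ x, twist K deg 1 (f x) = ((-1 : K) ^ (deg x + 1)) • f x)
    (hg' : ∀ x, twist K deg 1 (g x) = ((-1 : K) ^ (deg x + 1)) • g x)
    {S : Subalgebra K (SuperPoly K deg)} (hSf : S ≤ derKer 1 f hf) (hSg : S ≤ derKer 1 g hg)
    (hS : ∀ x, gen K deg x - laplacian f g hf hg (gen K deg x) ∈ S) (a : SuperPoly K deg) :
    ∃ s ∈ S, ∃ t ∈ positivePart f g hf hg, a = s + t := by
  have h0 : ∀ s ∈ S, s ∈ (laplacian f g hf hg).eigenspace 0 := fun s hs => by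
    rw [Module.End.mem_eigenspace_iff, laplacian_eq_zero hSf hSg hs, zero_smul]
  induction a using induction with
  | hc r => exact ⟨_, S.algebraMap_mem r, 0, zero_mem _, (add_zero _).symm⟩
  | hx x =>
    refine ⟨_, hS x, laplacian f g hf hg (gen K deg x),
      mem_positivePart_of_mem_eigenspace 0 ?_, (sub_add_cancel _ _).symm⟩
    have h := laplacian_eq_zero hSf hSg (hS x)
    rw [map_sub, sub_eq_zero] at h
    simpa [Module.End.mem_eigenspace_iff] using h.symm
  | hmul a b ha hb =>
    obtain ⟨s, hs, t, ht, rfl⟩ := ha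
    obtain ⟨s', hs', t', ht', rfl⟩ := hb
    refine ⟨s * s', mul_mem hs hs', s * t' + (t * s' + t * t'),
      add_mem ?_ (add_mem ?_ ?_), by rw [add_mul, mul_add, mul_add]; abel⟩
    · exact eigenspace_zero_mul_positivePart_le hf' hg' (Submodule.mul_mem_mul (h0 s hs) ht')
    · refine positivePart_mul_eigenspace_le hf' hg' 0 (Submodule.mul_mem_mul ht ?_)
      simpa using h0 s' hs'
    · exact positivePart_mul_self_le hf' hg' (Submodule.mul_mem_mul ht ht')
  | hadd a b ha hb =>
    obtain ⟨s, hs, t, ht, rfl⟩ := ha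
    obtain ⟨s', hs', t', ht', rfl⟩ := hb
    exact ⟨s + s', add_mem hs hs', t + t', add_mem ht ht', by abel⟩

/-- Under the assumptions of `exists_add_positivePart`, every class is represented in `S`: on the
positive part the anticommutator is invertible and commutes with the differential, so closed
elements are exact there. -/
theorem exists_add_der_eq [CharZero K]
    (hf' : ∀ x, twist K deg 1 (f x) = ((-1 : K) ^ (deg x + 1)) • f x)
    (hg' : ∀ x, twist K deg 1 (g x) = ((-1 : K) ^ (deg x + 1)) • g x)
    (hdd : ∀ a, der 1 f hf (der 1 f hf a) = 0)
    {S : Subalgebra K (SuperPoly K deg)} (hSf : S ≤ derKer 1 f hf) (hSg : S ≤ derKer 1 g hg)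
    (hS : ∀ x, gen K deg x - laplacian f g hf hg (gen K deg x) ∈ S) {a : SuperPoly K deg}
    (ha : der 1 f hf a = 0) : ∃ s ∈ S, ∃ b, s + der 1 f hf b = a := by
  obtain ⟨s, hs, t, ht, rfl⟩ := exists_add_positivePart hf' hg' hSf hSg hS a
  rw [map_add, mem_derKer.1 (hSf hs), zero_add] at ha
  obtain ⟨u, hu, rfl⟩ := exists_laplacian_eq ht
  have h1 : der 1 f hf u ∈ (laplacian f g hf hg).eigenspace 0 := by
    rw [Module.End.mem_eigenspace_iff, laplacian_der hdd, ha, zero_smul]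
  have h2 := Submodule.disjoint_def.1 disjoint_eigenspace_zero_positivePart _ h1
    (der_mem_positivePart hdd hu)
  exact ⟨s, hs, der 1 g hg u, by rw [laplacian_apply, h2, map_zero, add_zero]⟩

/-- Under the assumptions of `exists_add_positivePart`, `S` contains no nonzero coboundary. -/
theorem eq_zero_of_eq_der [CharZero K]
    (hf' : ∀ x, twist K deg 1 (f x) = ((-1 : K) ^ (deg x + 1)) • f x)
    (hg' : ∀ x, twist K deg 1 (g x) = ((-1 : K) ^ (deg x + 1)) • g x)
    (hdd : ∀ a, der 1 f hf (der 1 f hf a) = 0)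
    {S : Subalgebra K (SuperPoly K deg)} (hSf : S ≤ derKer 1 f hf) (hSg : S ≤ derKer 1 g hg)
    (hS : ∀ x, gen K deg x - laplacian f g hf hg (gen K deg x) ∈ S) {s b : SuperPoly K deg}
    (hs : s ∈ S) (h : der 1 f hf b = s) : s = 0 := by
  obtain ⟨s', hs', t, ht, rfl⟩ := exists_add_positivePart hf' hg' hSf hSg hS b
  rw [map_add, mem_derKer.1 (hSf hs'), zero_add] at h
  refine Submodule.disjoint_def.1 (disjoint_eigenspace_zero_positivePart (hf := hf) (hg := hg)) _
    ?_ (h ▸ der_mem_positivePart hdd ht)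
  rw [Module.End.mem_eigenspace_iff, laplacian_eq_zero hSf hSg hs, zero_smul]

end Laplacian

end

end SuperPoly

noncomputable section

/-! ### The Koszul complex of the jets -/

section Koszul

variable (K : Type*) [Field K] {n : ℕ}

theorem posSign_mul_self (s : Finset (Fin n)) (μ : Fin n) :
    posSign K s μ * posSign K s μ = 1 := by
  rw [posSign, ← mul_pow]; simp

variable {M : Type*} [AddCommGroup M] [Module K M]

/-- The Koszul differential of a family indexed by multi-indices and sets of form indices squares
to zero. -/
theorem koszul_sq (F : (Fin n →₀ ℕ) → Finset (Fin n) → M) (α : Fin n →₀ ℕ)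
    (s : Finset (Fin n)) :
    ∑ μ ∈ s, posSign K s μ • ∑ ν ∈ s.erase μ, posSign K (s.erase μ) ν •
      F (α + Finsupp.single μ 1 + Finsupp.single ν 1) ((s.erase μ).erase ν) = 0 := by
  simp only [Finset.smul_sum, smul_smul]
  rw [Finset.sum_sigma']
  refine Finset.sum_involution (fun x _ => ⟨x.2, x.1⟩) ?_ ?_ ?_ ?_
  · rintro ⟨μ, ν⟩ hx
    simp only [Finset.mem_sigma, Finset.mem_erase] at hx
    simp only
    rw [posSign_erase K hx.1 hx.2.2 hx.2.1.symm, Finset.erase_right_comm, add_right_comm,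
      neg_smul, neg_add_cancel]
  · rintro ⟨μ, ν⟩ hx _ h
    simp only [Finset.mem_sigma, Finset.mem_erase] at hx
    simp only [Sigma.mk.injEq] at h
    exact hx.2.1 h.1
  · rintro ⟨μ, ν⟩ hx
    simp only [Finset.mem_sigma, Finset.mem_erase] at hx ⊢
    exact ⟨hx.2.2, hx.2.1.symm, hx.1⟩
  · rintro ⟨μ, ν⟩ hx
    rfl

/-- The anticommutator of the Koszul differential and of contraction with the Euler vector field
multiplies by the total degree: the diagonal terms add up to it, and the others cancel in
pairs. -/
theorem koszul_homotopy (F : (Fin n →₀ ℕ) → Finset (Fin n) → M) (α : Fin n →₀ ℕ)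
    (s : Finset (Fin n)) :
    ∑ μ ∈ sᶜ, ((α μ : K) * posSign K (insert μ s) μ) •
        ∑ ν ∈ insert μ s, posSign K (insert μ s) ν •
          F (α - Finsupp.single μ 1 + Finsupp.single ν 1) ((insert μ s).erase ν) +
      ∑ ν ∈ s, posSign K s ν • ∑ μ ∈ (s.erase ν)ᶜ,
        (((α + Finsupp.single ν 1 : Fin n →₀ ℕ) μ : K) * posSign K (insert μ (s.erase ν)) μ) •
          F (α + Finsupp.single ν 1 - Finsupp.single μ 1) (insert μ (s.erase ν)) =
    ((α.degree + s.card : ℕ) : K) • F α s := by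
  have h1 : ∀ μ ∈ sᶜ, ((α μ : K) * posSign K (insert μ s) μ) •
        ∑ ν ∈ insert μ s, posSign K (insert μ s) ν •
          F (α - Finsupp.single μ 1 + Finsupp.single ν 1) ((insert μ s).erase ν) =
      (α μ : K) • F α s + ∑ ν ∈ s, ((α μ : K) * posSign K (insert μ s) μ *
        posSign K (insert μ s) ν) •
          F (α - Finsupp.single μ 1 + Finsupp.single ν 1) ((insert μ s).erase ν) := by
    intro μ hμ
    rw [Finset.mem_compl] at hμ
    rw [Finset.sum_insert hμ, Finset.erase_insert hμ, smul_add, smul_smul, mul_assoc,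
      posSign_mul_self, mul_one, Finset.smul_sum]
    simp only [smul_smul]
    congr 1
    rcases Nat.eq_zero_or_pos (α μ) with h | h
    · simp [h]
    · rw [tsub_add_cancel_of_le]
      simpa [Finsupp.single_le_iff, Nat.one_le_iff_ne_zero] using h.ne'
  have h2 : ∀ ν ∈ s, posSign K s ν • ∑ μ ∈ (s.erase ν)ᶜ,
        (((α + Finsupp.single ν 1 : Fin n →₀ ℕ) μ : K) * posSign K (insert μ (s.erase ν)) μ) •
          F (α + Finsupp.single ν 1 - Finsupp.single μ 1) (insert μ (s.erase ν)) =
      ((α ν : K) + 1) • F α s + ∑ μ ∈ sᶜ, -((α μ : K) * posSign K (insert μ s) μ *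
        posSign K (insert μ s) ν) •
          F (α - Finsupp.single μ 1 + Finsupp.single ν 1) ((insert μ s).erase ν) := by
    intro ν hν
    rw [Finset.compl_erase, Finset.sum_insert (by simpa using hν), Finset.insert_erase hν,
      smul_add, smul_smul, Finset.smul_sum]
    congr 1
    · rw [mul_left_comm, posSign_mul_self]
      simp
    · refine Finset.sum_congr rfl fun μ hμ => ?_
      rw [Finset.mem_compl] at hμ
      have hne : ν ≠ μ := fun h => hμ (h ▸ hν)
      have e1 : insert μ (s.erase ν) = (insert μ s).erase ν :=
        (Finset.erase_insert_of_ne hne.symm).symm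
      have e2 : (α + Finsupp.single ν 1 : Fin n →₀ ℕ) μ = α μ := by
        simp [hne]
      rw [e1, e2, smul_smul]
      rcases Nat.eq_zero_or_pos (α μ) with h | h
      · simp [h]
      have e3 : α + Finsupp.single ν 1 - Finsupp.single μ 1
          = α - Finsupp.single μ 1 + Finsupp.single ν 1 :=
        (tsub_add_eq_add_tsub
          (by simpa [Finsupp.single_le_iff, Nat.one_le_iff_ne_zero] using h.ne')).symm
      rw [e3]
      congr 1
      have h4 := posSign_erase K (Finset.mem_insert_self μ s) (Finset.mem_insert_of_mem hν) hne.symm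
      rw [Finset.erase_insert hμ] at h4
      have h5 := posSign_mul_self K (insert μ s) ν
      have h6 := posSign_mul_self K s ν
      -- `h4` times two of the signs, whose squares are `1` by `h5` and `h6`
      linear_combination (α μ : K) * posSign K (insert μ s) ν * posSign K s ν * h4 -
        (α μ : K) * posSign K s ν * posSign K ((insert μ s).erase ν) μ * h5 -
        (α μ : K) * posSign K (insert μ s) ν * posSign K (insert μ s) μ * h6
  rw [Finset.sum_congr rfl h1, Finset.sum_congr rfl h2, Finset.sum_add_distrib,
    Finset.sum_add_distrib, Finset.sum_comm (s := s), ← Finset.sum_smul, ← Finset.sum_smul]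
  simp only [neg_smul, Finset.sum_neg_distrib]
  rw [add_add_add_comm, add_neg_cancel, add_zero, ← add_smul]
  congr 1
  rw [Finsupp.degree_eq_sum, ← Finset.sum_compl_add_sum s]
  simp [Finset.sum_add_distrib, add_assoc]

end Koszul

/-! ### The contracting homotopy on the local functions -/

section Homotopy

variable (K : Type*) [Field K] {n : ℕ} {ι : Type*} {p : ι → ℕ}

/-- The component `∂_α B^a_s`, with the value `0` when `s` has more than `p a` elements. -/
def component (p : ι → ℕ) (a : ι) (α : Fin n →₀ ℕ) (s : Finset (Fin n)) : LocalFun K n p :=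
  if h : s.card ≤ p a then jet K ⟨a, α, s, h⟩ else 0

theorem component_of_le {a : ι} {α : Fin n →₀ ℕ} {s : Finset (Fin n)} (h : s.card ≤ p a) :
    component K p a α s = jet K ⟨a, α, s, h⟩ := dif_pos h

theorem jet_eq_component (j : Jet n p) : jet K j = component K p j.a j.α j.s :=
  (component_of_le K j.card_le).symm

theorem gammaFun_component {a : ι} {α : Fin n →₀ ℕ} {s : Finset (Fin n)} (h : s.card ≤ p a) :
    gammaFun K (component K p a α s) = (s.card : K)⁻¹ • ∑ μ ∈ s, posSign K s μ •
      component K p a (α + Finsupp.single μ 1) (s.erase μ) := by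
  rw [component_of_le K h, gammaFun_jet, gammaGen]
  simp only [jet_eq_component]
  rfl

/-- The value on `∂_α B_s`, `s.card = l < p`, of the contracting homotopy: the contraction with the
Euler vector field, normalized by `(l + 1) / (|α| + l)` so that its anticommutator with `γ` is the
identity on every `∂_α B_s` with `l < p`, except on the undifferentiated last ghost of ghost, which
it kills because of the factors `α μ` (the normalization is then the junk value `1 / 0 = 0`). On the
gauge fields, `l = p`, it is set to `0`, as there is no `B_t` with `t.card = p + 1`. -/
def homotopyGen (j : Jet n p) : LocalFun K n p :=
  if j.s.card < p j.a then
    ((j.s.card + 1 : ℕ) / (j.α.degree + j.s.card : ℕ) : K) • ∑ μ ∈ j.sᶜ,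
      ((j.α μ : K) * posSign K (insert μ j.s) μ) •
        component K p j.a (j.α - Finsupp.single μ 1) (insert μ j.s)
  else 0

/-- Adding an index to `B_s` below the top form degree gives a field whose ghost number is lower by
one. -/
theorem exists_jet_of_card_lt {j : Jet n p} (h : j.s.card < p j.a) {μ : Fin n} (hμ : μ ∈ j.sᶜ)
    (β : Fin n →₀ ℕ) : ∃ j' : Jet n p, component K p j.a β (insert μ j.s) = jet K j' ∧
      j.ghost = j'.ghost + 1 := by
  have hc : (insert μ j.s).card = j.s.card + 1 :=
    Finset.card_insert_of_notMem (by simpa using hμ)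
  have hle : (insert μ j.s).card ≤ p j.a := by omega
  refine ⟨⟨j.a, β, _, hle⟩, component_of_le K hle, ?_⟩
  simp only [Jet.ghost]
  omega

theorem hasShift_homotopyGen :
    SuperPoly.HasShift 1 (homotopyGen K : Jet n p → LocalFun K n p) := by
  intro x y
  rw [homotopyGen]
  split_ifs with h
  swap
  · simp
  simp only [smul_mul_assoc, mul_smul_comm, Finset.sum_mul, Finset.mul_sum]
  rw [smul_comm]
  congr 1
  rw [Finset.smul_sum]
  refine Finset.sum_congr rfl fun μ hμ => ?_
  obtain ⟨j', hj, hg⟩ := exists_jet_of_card_lt K h hμ (x.α - Finsupp.single μ 1)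
  rw [hj, hg, jet, SuperPoly.gen_comm, smul_comm]
  congr 1
  have he : Even ((1 + 1) * y.ghost) := ⟨y.ghost, by ring⟩
  rw [add_assoc, add_mul, pow_add _ (j'.ghost * _), he.neg_one_pow, mul_one]

theorem twist_homotopyGen (j : Jet n p) :
    SuperPoly.twist K Jet.ghost 1 (homotopyGen K j)
      = ((-1 : K) ^ (j.ghost + 1)) • homotopyGen K j := by
  rw [homotopyGen]
  split_ifs with h
  swap
  · simp
  simp only [map_smul, map_sum]
  rw [smul_comm ((-1 : K) ^ (j.ghost + 1))]
  congr 1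
  rw [Finset.smul_sum]
  refine Finset.sum_congr rfl fun μ hμ => ?_
  obtain ⟨j', hj, hg⟩ := exists_jet_of_card_lt K h hμ (j.α - Finsupp.single μ 1)
  rw [hj, hg, jet, SuperPoly.twist_gen, smul_comm, one_mul]
  congr 1
  rw [add_assoc, pow_add]
  simp

/-- The contracting homotopy, an odd derivation of the local functions. -/
def homotopy : LocalFun K n p →ₗ[K] LocalFun K n p :=
  SuperPoly.der 1 (homotopyGen K) (hasShift_homotopyGen K)

theorem homotopy_jet (j : Jet n p) : homotopy K (jet K j) = homotopyGen K j :=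
  SuperPoly.der_gen 1 (homotopyGen K) (hasShift_homotopyGen K) j

theorem homotopy_component_of_lt {a : ι} {α : Fin n →₀ ℕ} {s : Finset (Fin n)}
    (h : s.card < p a) : homotopy K (component K p a α s) =
      ((s.card + 1 : ℕ) / (α.degree + s.card : ℕ) : K) • ∑ μ ∈ sᶜ,
        ((α μ : K) * posSign K (insert μ s) μ) •
          component K p a (α - Finsupp.single μ 1) (insert μ s) := by
  rw [component_of_le K h.le, homotopy_jet, homotopyGen, if_pos h]

theorem homotopy_component_of_not_lt {a : ι} {α : Fin n →₀ ℕ} {s : Finset (Fin n)}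
    (h : ¬ s.card < p a) : homotopy K (component K p a α s) = 0 := by
  rw [component]
  split_ifs with h'
  · rw [homotopy_jet, homotopyGen, if_neg h]
  · exact map_zero _

/-! ### Derivatives of the field strengths -/

/-- The derivative `∂_α H^a_s` of a component of the field strength, for `s.card = p a + 1`. -/
def curvature (p : ι → ℕ) (a : ι) (α : Fin n →₀ ℕ) (s : Finset (Fin n)) : LocalFun K n p :=
  ∑ μ ∈ s, posSign K s μ • component K p a (α + Finsupp.single μ 1) (s.erase μ)

theorem foldr_totalDer_component (a : ι) (α : Fin n →₀ ℕ) (s : Finset (Fin n))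
    (l : List (Fin n)) :
    l.foldr (fun μ g => totalDer K μ g) (component K p a α s) =
      component K p a (α + Multiset.toFinsupp (l : Multiset (Fin n))) s := by
  induction l with
  | nil => simp
  | cons μ l ih =>
    rw [List.foldr_cons, ih, component, component]
    split_ifs with h
    · rw [totalDer_jet, Jet.shift, ← Multiset.cons_coe, ← Multiset.singleton_add, map_add,
        Multiset.toFinsupp_singleton]
      simp only [add_assoc, add_comm (Finsupp.single μ 1)]
    · exact map_zero _

theorem foldr_totalDer_sum {σ : Type*} (t : Finset σ) (c : σ → K) (f : σ → LocalFun K n p)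
    (l : List (Fin n)) :
    l.foldr (fun μ g => totalDer K μ g) (∑ x ∈ t, c x • f x) =
      ∑ x ∈ t, c x • l.foldr (fun μ g => totalDer K μ g) (f x) := by
  induction l with
  | nil => rfl
  | cons μ l ih => simp only [List.foldr_cons, ih, map_sum, map_smul]

theorem foldr_totalDer_fieldStrength (a : ι) (s : Finset (Fin n)) (hs : s.card = p a + 1)
    (l : List (Fin n)) :
    l.foldr (fun μ g => totalDer K μ g) (fieldStrength K a s hs) =
      curvature K p a (Multiset.toFinsupp (l : Multiset (Fin n))) s := by
  rw [curvature, ← Finset.sum_attach, fieldStrength, foldr_totalDer_sum]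
  refine Finset.sum_congr rfl fun μ _ => ?_
  rw [totalDer_jet, jet_eq_component, foldr_totalDer_component]
  simp only [Jet.shift, zero_add]
  rw [add_comm]

theorem curvature_mem (a : ι) (α : Fin n →₀ ℕ) (s : Finset (Fin n)) (hs : s.card = p a + 1) :
    curvature K p a α s ∈ curvatureAlg K n p := by
  refine Algebra.subset_adjoin ⟨a, s, hs, (Finsupp.toMultiset α).toList, ?_⟩
  rw [foldr_totalDer_fieldStrength, Multiset.coe_toList]
  congr 1
  exact (Finsupp.toMultiset_toFinsupp α).symm

theorem curvatureAlg_le {S : Subalgebra K (LocalFun K n p)}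
    (h : ∀ (a : ι) (α : Fin n →₀ ℕ) (s : Finset (Fin n)), s.card = p a + 1 →
      curvature K p a α s ∈ S) : curvatureAlg K n p ≤ S := by
  refine Algebra.adjoin_le ?_
  rintro _ ⟨a, s, hs, l, rfl⟩
  rw [foldr_totalDer_fieldStrength]
  exact h a _ s hs

theorem lastGhostAlg_le {S : Subalgebra K (LocalFun K n p)}
    (h : ∀ a : ι, component K p a 0 ∅ ∈ S) : lastGhostAlg K n p ≤ S := by
  refine Algebra.adjoin_le ?_
  rintro _ ⟨a, rfl⟩
  rw [lastGhost, jet_eq_component]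
  exact h a

theorem card_erase_of_mem_of_card {a : ι} {s : Finset (Fin n)} (hs : s.card = p a + 1)
    {μ : Fin n} (hμ : μ ∈ s) : (s.erase μ).card = p a := by
  rw [Finset.card_erase_of_mem hμ, hs, Nat.add_sub_cancel]

theorem gammaFun_curvature (a : ι) (α : Fin n →₀ ℕ) (s : Finset (Fin n))
    (hs : s.card = p a + 1) : gammaFun K (curvature K p a α s) = 0 := by
  have h : ∀ μ ∈ s, posSign K s μ • gammaFun K
      (component K p a (α + Finsupp.single μ 1) (s.erase μ)) =
      (p a : K)⁻¹ • (posSign K s μ • ∑ ν ∈ s.erase μ, posSign K (s.erase μ) ν •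
        component K p a (α + Finsupp.single μ 1 + Finsupp.single ν 1) ((s.erase μ).erase ν)) := by
    intro μ hμ
    have hc := card_erase_of_mem_of_card hs hμ
    rw [gammaFun_component K hc.le, hc, smul_comm]
  simp only [curvature, map_sum, map_smul]
  rw [Finset.sum_congr rfl h, ← Finset.smul_sum, koszul_sq, smul_zero]

theorem homotopy_curvature (a : ι) (α : Fin n →₀ ℕ) (s : Finset (Fin n))
    (hs : s.card = p a + 1) : homotopy K (curvature K p a α s) = 0 := by
  simp only [curvature, map_sum, map_smul]
  refine Finset.sum_eq_zero fun μ hμ => ?_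
  rw [homotopy_component_of_not_lt K (by simp [card_erase_of_mem_of_card hs hμ]), smul_zero]

theorem curvatureAlg_le_gammaKer :
    curvatureAlg K n p ≤ SuperPoly.derKer 1 (gammaGen K) (hasShift_gammaGen K) :=
  curvatureAlg_le K (gammaFun_curvature K)

theorem curvatureAlg_le_homotopyKer :
    curvatureAlg K n p ≤ SuperPoly.derKer 1 (homotopyGen K) (hasShift_homotopyGen K) :=
  curvatureAlg_le K (homotopy_curvature K)

theorem lastGhostAlg_le_gammaKer :
    lastGhostAlg K n p ≤ SuperPoly.derKer 1 (gammaGen K) (hasShift_gammaGen K) := by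
  refine lastGhostAlg_le K fun a => ?_
  change gammaFun K _ = 0
  rw [gammaFun_component K (by simp)]
  simp

theorem lastGhostAlg_le_homotopyKer :
    lastGhostAlg K n p ≤ SuperPoly.derKer 1 (homotopyGen K) (hasShift_homotopyGen K) := by
  refine lastGhostAlg_le K fun a => ?_
  change homotopy K _ = 0
  by_cases h : (∅ : Finset (Fin n)).card < p a
  · rw [homotopy_component_of_lt K h]
    simp
  · exact homotopy_component_of_not_lt K h

/-! ### The anticommutator on the generators -/

/-- On the generators, the anticommutator of `γ` and the homotopy is the identity up to
polynomials in the curvatures and the last ghosts of ghosts. -/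
theorem jet_sub_laplacian_mem [CharZero K] {S : Subalgebra K (LocalFun K n p)}
    (hI : curvatureAlg K n p ≤ S) (hC : lastGhostAlg K n p ≤ S) (j : Jet n p) :
    jet K j - (gammaFun K (homotopy K (jet K j)) + homotopy K (gammaFun K (jet K j))) ∈ S := by
  obtain ⟨a, α, s, hs⟩ := j
  rw [← component_of_le]
  by_cases h0 : α.degree + s.card = 0
  · -- Total degree `0`: the generator is an undifferentiated last ghost of ghost, which `γ` and the
    -- homotopy kill.
    obtain ⟨hα, hs0⟩ := Nat.add_eq_zero_iff.1 h0
    obtain rfl : s = ∅ := Finset.card_eq_zero.1 hs0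
    obtain rfl : α = 0 := (Finsupp.degree_eq_zero_iff α).1 hα
    have hmem : component K p a 0 ∅ ∈ lastGhostAlg K n p := by
      rw [component_of_le K (by simp)]
      exact Algebra.subset_adjoin ⟨a, rfl⟩
    have h1 : gammaFun K (component K p a 0 ∅) = 0 := lastGhostAlg_le_gammaKer K hmem
    have h2 : homotopy K (component K p a 0 ∅) = 0 := lastGhostAlg_le_homotopyKer K hmem
    rw [h1, h2, map_zero, map_zero, add_zero, sub_zero]
    exact hC hmem
  have h0' : ((α.degree + s.card : ℕ) : K) ≠ 0 := Nat.cast_ne_zero.2 h0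
  have hdeg : ∀ ν ∈ s, (α + Finsupp.single ν 1).degree + (s.erase ν).card =
      α.degree + s.card := by
    intro ν hν
    have := Finset.card_erase_add_one hν
    rw [map_add, Finsupp.degree_single]
    omega
  -- `homotopy ∘ γ` only involves `B_t` with `t.card ≤ s.card`, so the truncation at `p a` does not
  -- affect this half of the Koszul identity.
  have hrg : ((α.degree + s.card : ℕ) : K) • homotopy K (gammaFun K (component K p a α s)) =
      ∑ ν ∈ s, posSign K s ν • ∑ μ ∈ (s.erase ν)ᶜ,
        (((α + Finsupp.single ν 1 : Fin n →₀ ℕ) μ : K) * posSign K (insert μ (s.erase ν)) μ) •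
          component K p a (α + Finsupp.single ν 1 - Finsupp.single μ 1)
            (insert μ (s.erase ν)) := by
    rw [gammaFun_component K hs, map_smul, map_sum, Finset.smul_sum, Finset.smul_sum]
    refine Finset.sum_congr rfl fun ν hν => ?_
    have hc := Finset.card_erase_add_one hν
    have hne : (s.card : K) ≠ 0 := Nat.cast_ne_zero.2 (by omega)
    rw [map_smul, homotopy_component_of_lt K (by omega), hdeg ν hν, hc,
      smul_comm (posSign K s ν), smul_smul, smul_smul]
    rw [show ((α.degree + s.card : ℕ) : K) * (s.card : K)⁻¹ *
      ((s.card : K) / ((α.degree + s.card : ℕ) : K)) = 1 by field_simp, one_smul]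
  have key := koszul_homotopy K (component K p a) α s
  rw [← hrg] at key
  by_cases hlt : s.card < p a
  · have hgr : ((α.degree + s.card : ℕ) : K) • gammaFun K (homotopy K (component K p a α s)) =
        ∑ μ ∈ sᶜ, ((α μ : K) * posSign K (insert μ s) μ) •
        ∑ ν ∈ insert μ s, posSign K (insert μ s) ν •
          component K p a (α - Finsupp.single μ 1 + Finsupp.single ν 1)
            ((insert μ s).erase ν) := by
      rw [homotopy_component_of_lt K hlt, map_smul, map_sum, Finset.smul_sum, Finset.smul_sum]
      refine Finset.sum_congr rfl fun μ hμ => ?_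
      have hc : (insert μ s).card = s.card + 1 :=
        Finset.card_insert_of_notMem (by simpa using hμ)
      have hne : ((s.card + 1 : ℕ) : K) ≠ 0 := Nat.cast_ne_zero.2 (by omega)
      rw [map_smul, gammaFun_component K (by omega), hc, smul_smul, smul_smul, smul_smul]
      congr 1
      field_simp
    rw [← hgr, ← smul_add] at key
    rw [smul_right_injective _ h0' key, sub_self]
    exact zero_mem S
  · -- For a gauge field the homotopy vanishes, and the other half of the Koszul identity, which
    -- formally involves `B_t` with `t.card = p a + 1`, is a combination of curvatures.
    have hrw : component K p a α s - (gammaFun K (homotopy K (component K p a α s)) +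
        homotopy K (gammaFun K (component K p a α s))) =
        ((α.degree + s.card : ℕ) : K)⁻¹ • ∑ μ ∈ sᶜ, ((α μ : K) * posSign K (insert μ s) μ) •
          curvature K p a (α - Finsupp.single μ 1) (insert μ s) := by
      rw [eq_inv_smul_iff₀ h0', smul_sub, smul_add, ← key, homotopy_component_of_not_lt K hlt,
        map_zero, smul_zero, zero_add, add_sub_cancel_right]
      rfl
    rw [hrw]
    refine S.smul_mem (S.sum_mem fun μ hμ => S.smul_mem (hI (curvature_mem K a _ _ ?_)) _) _
    rw [Finset.card_insert_of_notMem (by simpa using hμ)]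
    omega


end Homotopy

/-! ### Cohomology classes -/

namespace OddDifferential

variable {K A B : Type*} [Field K] [Ring A] [Algebra K A] (D : OddDifferential K A)

theorem cls_smul (r : K) {a : A} (ha : D.d a = 0) :
    r • D.cls a ha = D.cls (r • a) (D.cocycles.smul_mem ha r) := rfl

theorem cls_eq_cls {a b : A} (ha : D.d a = 0) (hb : D.d b = 0) :
    D.cls a ha = D.cls b hb ↔ ∃ c, D.d c = a - b :=
  Ideal.Quotient.eq

theorem cls_congr {a b : A} (ha : D.d a = 0) (h : a = b) :
    D.cls a ha = D.cls b (h ▸ ha) := by subst h; rfl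

/-- A linear map into the cocycles induces a bijection onto the cohomology if its range is a
complement of the coboundaries and it is injective. -/
theorem cls_bijective [AddCommGroup B] [Module K B] (φ : B →ₗ[K] A) (hφ : ∀ b, D.d (φ b) = 0)
    (hinj : ∀ b c, D.d c = φ b → b = 0) (hsurj : ∀ a, D.d a = 0 → ∃ b c, φ b + D.d c = a) :
    Function.Bijective fun b => D.cls (φ b) (hφ b) := by
  refine ⟨fun b b' h => ?_, fun x => ?_⟩
  · obtain ⟨c, hc⟩ := (D.cls_eq_cls _ _).1 h
    rw [← map_sub] at hc
    exact sub_eq_zero.1 (hinj _ c hc)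
  · obtain ⟨⟨a, ha⟩, rfl⟩ := Ideal.Quotient.mk_surjective x
    obtain ⟨b, c, h⟩ := hsurj a ha
    exact ⟨b, (D.cls_eq_cls _ ha).2 ⟨-c, by rw [map_neg, ← h]; abel⟩⟩

end OddDifferential

/-! ### Local functions -/

section Functions

variable (K : Type*) [Field K] {n : ℕ} {ι : Type*} {p : ι → ℕ}

theorem twist_of_mem_curvatureAlg {i : LocalFun K n p} (hi : i ∈ curvatureAlg K n p) :
    SuperPoly.twist K Jet.ghost 1 i = i := by
  revert i
  change curvatureAlg K n p ≤
    AlgHom.equalizer (SuperPoly.twist K Jet.ghost 1) (AlgHom.id K (LocalFun K n p))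
  refine curvatureAlg_le K fun a α s hs => ?_
  simp only [curvature, AlgHom.mem_equalizer, map_sum, map_smul, AlgHom.id_apply]
  refine Finset.sum_congr rfl fun μ hμ => ?_
  have hc := card_erase_of_mem_of_card hs hμ
  rw [component_of_le K hc.le, jet, SuperPoly.twist_gen]
  simp [Jet.ghost, hc]

theorem commute_of_mem_curvatureAlg {i : LocalFun K n p} (hi : i ∈ curvatureAlg K n p)
    (f : LocalFun K n p) : Commute i f :=
  SuperPoly.commute_of_even (twist_of_mem_curvatureAlg K hi) f

/-- The multiplication map `i ⊗ c ↦ i c`. -/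
def mulHom (n : ℕ) {ι : Type*} (p : ι → ℕ) :
    curvatureAlg K n p ⊗[K] lastGhostAlg K n p →ₐ[K] LocalFun K n p :=
  Algebra.TensorProduct.lift (curvatureAlg K n p).val (lastGhostAlg K n p).val
    fun i c => commute_of_mem_curvatureAlg K i.2 c

theorem mulHom_tmul (i : curvatureAlg K n p) (c : lastGhostAlg K n p) :
    mulHom K n p (i ⊗ₜ c) = (i : LocalFun K n p) * c :=
  Algebra.TensorProduct.lift_tmul _ _ _ _ _

/-- The homomorphism that places the gauge fields, which have ghost number `0`, in the left factor
and all the other generators in the right factor. As the gauge fields are even, no sign is needed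
in the product of the target. -/
def separate (n : ℕ) {ι : Type*} (p : ι → ℕ) :
    LocalFun K n p →ₐ[K] LocalFun K n p ⊗[K] LocalFun K n p :=
  SuperPoly.lift (fun j => if j.s.card = p j.a then jet K j ⊗ₜ 1 else 1 ⊗ₜ jet K j) fun x y => by
    have h0 : ∀ z : Jet n p, z.s.card = p z.a → z.ghost = 0 := fun z hz => by
      simp [Jet.ghost, hz]
    have hc : jet K x * jet K y = (-1 : K) ^ (x.ghost * y.ghost) • (jet K y * jet K x) :=
      SuperPoly.gen_comm x y
    split_ifs with hx hy hy
    · simp [hc, TensorProduct.smul_tmul']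
    · simp [h0 x hx]
    · simp [h0 y hy]
    · simp [hc]

theorem separate_of_mem_curvatureAlg {i : LocalFun K n p} (hi : i ∈ curvatureAlg K n p) :
    separate K n p i = i ⊗ₜ 1 := by
  revert i
  change curvatureAlg K n p ≤
    AlgHom.equalizer (separate K n p) Algebra.TensorProduct.includeLeft
  refine curvatureAlg_le K fun a α s hs => ?_
  simp only [curvature, AlgHom.mem_equalizer, map_sum, map_smul]
  refine Finset.sum_congr rfl fun μ hμ => ?_
  have hc := card_erase_of_mem_of_card hs hμ
  rw [component_of_le K hc.le, jet, separate, SuperPoly.lift_gen, if_pos hc]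
  rfl

theorem separate_of_mem_lastGhostAlg (hp : ∀ a, 1 ≤ p a) {c : LocalFun K n p}
    (hc : c ∈ lastGhostAlg K n p) : separate K n p c = 1 ⊗ₜ c := by
  revert c
  change lastGhostAlg K n p ≤
    AlgHom.equalizer (separate K n p) Algebra.TensorProduct.includeRight
  refine lastGhostAlg_le K fun a => ?_
  have h : (∅ : Finset (Fin n)).card ≠ p a := by
    have := hp a
    simp only [Finset.card_empty]
    omega
  rw [AlgHom.mem_equalizer, component_of_le K (by simp), jet, separate, SuperPoly.lift_gen,
    if_neg h]
  rfl

/-- The curvatures and the last ghosts of ghosts involve disjoint sets of generators. -/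
theorem mulHom_injective (hp : ∀ a, 1 ≤ p a) : Function.Injective (mulHom K n p) := by
  have h : (separate K n p).toLinearMap ∘ₗ (mulHom K n p).toLinearMap =
      TensorProduct.map (curvatureAlg K n p).val.toLinearMap
        (lastGhostAlg K n p).val.toLinearMap := by
    refine TensorProduct.ext' fun i c => ?_
    simp only [LinearMap.comp_apply, AlgHom.toLinearMap_apply, TensorProduct.map_tmul]
    rw [mulHom_tmul, map_mul, separate_of_mem_curvatureAlg K i.2,
      separate_of_mem_lastGhostAlg K hp c.2]
    simp
  have h' : Function.Injective ((separate K n p).toLinearMap ∘ₗ (mulHom K n p).toLinearMap) := by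
    rw [h]
    exact TensorProduct.map_injective_of_flat_flat _ _ Subtype.val_injective
      Subtype.val_injective
  exact Function.Injective.of_comp (f := separate K n p) h'

theorem mulHom_range_le {S : Subalgebra K (LocalFun K n p)} (hI : curvatureAlg K n p ≤ S)
    (hC : lastGhostAlg K n p ≤ S) : (mulHom K n p).range ≤ S := by
  rintro _ ⟨z, rfl⟩
  change mulHom K n p z ∈ S
  induction z using TensorProduct.induction_on with
  | zero => rw [map_zero]; exact zero_mem S
  | tmul i c => rw [mulHom_tmul]; exact mul_mem (hI i.2) (hC c.2)
  | add x y hx hy => rw [map_add]; exact add_mem hx hy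

theorem le_mulHom_range_left : curvatureAlg K n p ≤ (mulHom K n p).range := fun i hi =>
  ⟨⟨i, hi⟩ ⊗ₜ 1, (mulHom_tmul K _ _).trans (mul_one i)⟩

theorem le_mulHom_range_right : lastGhostAlg K n p ≤ (mulHom K n p).range := fun c hc =>
  ⟨1 ⊗ₜ ⟨c, hc⟩, (mulHom_tmul K _ _).trans (one_mul c)⟩

theorem gammaFun_mulHom (z : curvatureAlg K n p ⊗[K] lastGhostAlg K n p) :
    gammaFun K (mulHom K n p z) = 0 :=
  mulHom_range_le K (curvatureAlg_le_gammaKer K) (lastGhostAlg_le_gammaKer K) ⟨z, rfl⟩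

/-- Every `γ`-closed local function is cohomologous to a polynomial in the curvatures and the last
ghosts of ghosts. -/
theorem exists_mulHom_add_gammaFun [CharZero K] {f : LocalFun K n p} (hf : gammaFun K f = 0) :
    ∃ z g, mulHom K n p z + gammaFun K g = f := by
  obtain ⟨_, ⟨z, rfl⟩, g, h⟩ := SuperPoly.exists_add_der_eq (twist_gammaGen K)
    (twist_homotopyGen K) (funComplex K n p).d_d
    (mulHom_range_le K (curvatureAlg_le_gammaKer K) (lastGhostAlg_le_gammaKer K))
    (mulHom_range_le K (curvatureAlg_le_homotopyKer K) (lastGhostAlg_le_homotopyKer K))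
    (jet_sub_laplacian_mem K (le_mulHom_range_left K) (le_mulHom_range_right K)) hf
  exact ⟨z, g, h⟩

/-- No nonzero polynomial in the curvatures and the last ghosts of ghosts is `γ`-exact. -/
theorem eq_zero_of_gammaFun_eq_mulHom [CharZero K] (hp : ∀ a, 1 ≤ p a)
    {z : curvatureAlg K n p ⊗[K] lastGhostAlg K n p} {g : LocalFun K n p}
    (h : gammaFun K g = mulHom K n p z) : z = 0 := by
  refine mulHom_injective K hp (Eq.trans ?_ (map_zero _).symm)
  exact SuperPoly.eq_zero_of_eq_der (twist_gammaGen K)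
    (twist_homotopyGen K) (funComplex K n p).d_d
    (mulHom_range_le K (curvatureAlg_le_gammaKer K) (lastGhostAlg_le_gammaKer K))
    (mulHom_range_le K (curvatureAlg_le_homotopyKer K) (lastGhostAlg_le_homotopyKer K))
    (jet_sub_laplacian_mem K (le_mulHom_range_left K) (le_mulHom_range_right K)) ⟨z, rfl⟩ h

/-- The algebra homomorphism `i ⊗ c ↦ [i c]`. -/
def funClass (n : ℕ) {ι : Type*} (p : ι → ℕ) :
    curvatureAlg K n p ⊗[K] lastGhostAlg K n p →ₐ[K] (funComplex K n p).Cohomology :=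
  (Ideal.Quotient.mkₐ K (funComplex K n p).coboundaries).comp
    ((mulHom K n p).codRestrict (funComplex K n p).cocycles (gammaFun_mulHom K))

theorem funClass_bijective [CharZero K] (hp : ∀ a, 1 ≤ p a) :
    Function.Bijective (funClass K n p) := by
  have h := (funComplex K n p).cls_bijective
    (B := curvatureAlg K n p ⊗[K] lastGhostAlg K n p)
    (mulHom K n p).toLinearMap (gammaFun_mulHom K)
    (fun _ _ h => eq_zero_of_gammaFun_eq_mulHom K hp h)
    (fun _ h => exists_mulHom_add_gammaFun K h)
  exact h

end Functions

/-! ### Local forms -/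

section Forms

variable (K : Type*) [Field K] {n : ℕ} {ι : Type*} {p : ι → ℕ}

theorem constFormAlg_le {S : Subalgebra K (LocalForm K n p)} (h : ∀ μ, dx K p μ ∈ S) :
    constFormAlg K n p ≤ S := by
  refine Algebra.adjoin_le ?_
  rintro _ ⟨μ, rfl⟩
  exact h μ

theorem dx_mem (μ : Fin n) : dx K p μ ∈ constFormAlg K n p := Algebra.subset_adjoin ⟨μ, rfl⟩

theorem twist_mem_constFormAlg (e : ℕ) {w : LocalForm K n p} (hw : w ∈ constFormAlg K n p) :
    SuperPoly.twist K formDeg e w ∈ constFormAlg K n p := by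
  revert w
  change constFormAlg K n p ≤ (constFormAlg K n p).comap (SuperPoly.twist K formDeg e)
  refine constFormAlg_le K fun μ => ?_
  rw [Subalgebra.mem_comap, dx, SuperPoly.twist_gen]
  exact Subalgebra.smul_mem _ (dx_mem K μ) _

theorem gamma_of_mem_constFormAlg {w : LocalForm K n p} (hw : w ∈ constFormAlg K n p) :
    gamma K w = 0 := by
  revert w
  change constFormAlg K n p ≤ SuperPoly.derKer 1 (gammaFormGen K) (hasShift_gammaFormGen K)
  exact constFormAlg_le K fun μ => SuperPoly.der_gen _ _ _ _

/-- The map `w ⊗ f ↦ w f` from the constant forms and the local functions to the local forms. -/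
def formMul (n : ℕ) {ι : Type*} (p : ι → ℕ) :
    constFormAlg K n p ⊗[K] LocalFun K n p →ₗ[K] LocalForm K n p :=
  LinearMap.mul' K (LocalForm K n p) ∘ₗ
    TensorProduct.map (constFormAlg K n p).val.toLinearMap (toForm K).toLinearMap

theorem formMul_tmul (w : constFormAlg K n p) (f : LocalFun K n p) :
    formMul K n p (w ⊗ₜ f) = (w : LocalForm K n p) * toForm K f := rfl

/-- Differentials can be moved to the left of local functions: the range of `formMul` contains `1`
and is stable under left multiplication by the generators. -/
theorem formMul_surjective : Function.Surjective (formMul K n p) := by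
  suffices h : ∀ a : LocalForm K n p, ∀ b ∈ LinearMap.range (formMul K n p),
      a * b ∈ LinearMap.range (formMul K n p) by
    intro a
    have h1 : (1 : LocalForm K n p) ∈ LinearMap.range (formMul K n p) :=
      ⟨1 ⊗ₜ 1, by simp [formMul_tmul]⟩
    simpa using h a 1 h1
  intro a
  induction a using SuperPoly.induction with
  | hc r =>
    intro b hb
    rw [← Algebra.smul_def]
    exact Submodule.smul_mem _ r hb
  | hmul a a' ha ha' => intro b hb; rw [mul_assoc]; exact ha _ (ha' b hb)
  | hadd a a' ha ha' => intro b hb; rw [add_mul]; exact add_mem (ha b hb) (ha' b hb)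
  | hx x =>
    rintro _ ⟨z, rfl⟩
    induction z using TensorProduct.induction_on with
    | zero => rw [map_zero, mul_zero]; exact zero_mem _
    | add y z hy hz => rw [map_add, mul_add]; exact add_mem hy hz
    | tmul w f =>
      rw [formMul_tmul, ← mul_assoc]
      rcases x with μ | j
      · exact ⟨(⟨dx K p μ, dx_mem K μ⟩ * w) ⊗ₜ f, rfl⟩
      · rw [SuperPoly.gen_mul, mul_assoc, ← toForm_jet, ← map_mul]
        exact ⟨⟨_, twist_mem_constFormAlg K _ w.2⟩ ⊗ₜ (jet K j * f), rfl⟩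

/-- The homomorphism into an ungraded tensor product that sends `dx` to left multiplication by
`dx`, and a jet variable `x` to the pair of `x` and the parity automorphism to the power of the
parity of `x`. The automorphism supplies the sign of a graded tensor product. -/
def formSeparate (n : ℕ) {ι : Type*} (p : ι → ℕ) :
    LocalForm K n p →ₐ[K] Module.End K (LocalForm K n p) ⊗[K] LocalFun K n p :=
  SuperPoly.lift (Sum.elim (fun μ => Algebra.lmul K (LocalForm K n p) (dx K p μ) ⊗ₜ 1)
    fun j => (SuperPoly.twist K formDeg j.ghost).toLinearMap ⊗ₜ jet K j) fun x y => by
    have key : ∀ (μ : Fin n) (j : Jet n p),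
        (SuperPoly.twist K formDeg j.ghost).toLinearMap *
          Algebra.lmul K (LocalForm K n p) (dx K p μ) =
        (-1 : K) ^ j.ghost • (Algebra.lmul K (LocalForm K n p) (dx K p μ) *
          (SuperPoly.twist K formDeg j.ghost).toLinearMap) := by
      intro μ j
      refine LinearMap.ext fun a => ?_
      change SuperPoly.twist K formDeg j.ghost (dx K p μ * a) =
        (-1 : K) ^ j.ghost • (dx K p μ * SuperPoly.twist K formDeg j.ghost a)
      rw [map_mul, dx, SuperPoly.twist_gen, smul_mul_assoc,
        show formDeg (Sum.inl μ : Fin n ⊕ Jet n p) = 1 from rfl, mul_one]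
    rcases x with μ | j <;> rcases y with ν | k
    · have h : dx K p μ * dx K p ν = (-1 : K) ^ (1 * 1) • (dx K p ν * dx K p μ) :=
        SuperPoly.gen_comm (deg := formDeg) (Sum.inl μ) (Sum.inl ν)
      simp only [Sum.elim_inl, Algebra.TensorProduct.tmul_mul_tmul, ← map_mul, h, map_smul,
        TensorProduct.smul_tmul']
      rfl
    · have h : formDeg (Sum.inl μ : Fin n ⊕ Jet n p) * formDeg (Sum.inr k : Fin n ⊕ Jet n p) =
        k.ghost := one_mul _
      rw [h, Sum.elim_inl, Sum.elim_inr, Algebra.TensorProduct.tmul_mul_tmul,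
        Algebra.TensorProduct.tmul_mul_tmul, key, mul_one, one_mul, TensorProduct.smul_tmul',
        smul_smul, ← mul_pow]
      simp only [mul_neg, mul_one, neg_neg, one_pow, one_smul]
    · have h : formDeg (Sum.inr j : Fin n ⊕ Jet n p) * formDeg (Sum.inl ν : Fin n ⊕ Jet n p) =
        j.ghost := mul_one _
      rw [h, Sum.elim_inl, Sum.elim_inr, Algebra.TensorProduct.tmul_mul_tmul,
        Algebra.TensorProduct.tmul_mul_tmul, key, mul_one, one_mul, TensorProduct.smul_tmul']
    · have h : jet K j * jet K k = (-1 : K) ^ (j.ghost * k.ghost) • (jet K k * jet K j) :=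
        SuperPoly.gen_comm j k
      have h' : (SuperPoly.twist K (formDeg : Fin n ⊕ Jet n p → ℕ) j.ghost).toLinearMap *
          (SuperPoly.twist K formDeg k.ghost).toLinearMap =
          (SuperPoly.twist K formDeg k.ghost).toLinearMap *
          (SuperPoly.twist K formDeg j.ghost).toLinearMap := by
        refine LinearMap.ext fun a => ?_
        simp only [Module.End.mul_apply, AlgHom.toLinearMap_apply]
        rw [← SuperPoly.twist_add, add_comm, SuperPoly.twist_add]
      rw [Sum.elim_inr, Sum.elim_inr, Algebra.TensorProduct.tmul_mul_tmul,
        Algebra.TensorProduct.tmul_mul_tmul, h, h', TensorProduct.tmul_smul]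
      rfl

/-- Evaluation at `1` of the endomorphism in the first factor. It turns `formSeparate` into a left
inverse of `w ⊗ f ↦ w f`. -/
def evalOne (n : ℕ) {ι : Type*} (p : ι → ℕ) :
    Module.End K (LocalForm K n p) ⊗[K] LocalFun K n p →ₗ[K]
      LocalForm K n p ⊗[K] LocalFun K n p :=
  LinearMap.rTensor _ (LinearMap.applyₗ 1)

theorem evalOne_mul_formSeparate (f : LocalFun K n p)
    (E : Module.End K (LocalForm K n p) ⊗[K] LocalFun K n p) :
    evalOne K n p (E * formSeparate K n p (toForm K f)) = evalOne K n p E * (1 ⊗ₜ f) := by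
  induction f using SuperPoly.induction generalizing E with
  | hc r =>
    rw [AlgHom.commutes, AlgHom.commutes, Algebra.algebraMap_eq_smul_one,
      Algebra.algebraMap_eq_smul_one, TensorProduct.tmul_smul, mul_smul_comm, mul_smul_comm,
      mul_one, map_smul, ← Algebra.TensorProduct.one_def, mul_one]
  | hx j =>
    rw [← jet, toForm_jet, formSeparate, SuperPoly.lift_gen, Sum.elim_inr]
    induction E using TensorProduct.induction_on with
    | zero => simp
    | add E F hE hF => rw [add_mul, map_add, hE, hF, map_add, add_mul]
    | tmul u g => simp [evalOne, Module.End.mul_apply]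
  | hmul f g hf hg =>
    rw [map_mul (toForm K), map_mul (formSeparate K n p), ← mul_assoc, hg, hf, mul_assoc,
      Algebra.TensorProduct.tmul_mul_tmul, one_mul]
  | hadd f g hf hg => simp only [map_add, mul_add, hf, hg, TensorProduct.tmul_add]

theorem formSeparate_of_mem_constFormAlg {w : LocalForm K n p} (hw : w ∈ constFormAlg K n p) :
    formSeparate K n p w = Algebra.lmul K (LocalForm K n p) w ⊗ₜ 1 := by
  revert w
  change constFormAlg K n p ≤ AlgHom.equalizer (formSeparate K n p)
    (Algebra.TensorProduct.includeLeft.comp (Algebra.lmul K (LocalForm K n p)))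
  refine constFormAlg_le K fun μ => ?_
  rw [AlgHom.mem_equalizer, dx, formSeparate, SuperPoly.lift_gen]
  rfl

theorem formMul_injective : Function.Injective (formMul K n p) := by
  have h : evalOne K n p ∘ₗ (formSeparate K n p).toLinearMap ∘ₗ formMul K n p =
      LinearMap.rTensor _ (constFormAlg K n p).val.toLinearMap := by
    refine TensorProduct.ext' fun w f => ?_
    simp only [LinearMap.comp_apply, AlgHom.toLinearMap_apply, LinearMap.rTensor_tmul]
    rw [formMul_tmul, map_mul, evalOne_mul_formSeparate, formSeparate_of_mem_constFormAlg K w.2]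
    simp [evalOne]
  have h' : Function.Injective
      (evalOne K n p ∘ₗ (formSeparate K n p).toLinearMap ∘ₗ formMul K n p) := by
    rw [h]
    exact Module.Flat.rTensor_preserves_injective_linearMap _ Subtype.val_injective
  rw [← LinearMap.comp_assoc] at h'
  exact Function.Injective.of_comp (f := evalOne K n p ∘ₗ (formSeparate K n p).toLinearMap) h'

/-- The parity involution of the constant forms. -/
def constParity (n : ℕ) {ι : Type*} (p : ι → ℕ) : constFormAlg K n p →ₗ[K] constFormAlg K n p :=
  (SuperPoly.twist K formDeg 1).toLinearMap.restrict (p := (constFormAlg K n p).toSubmodule)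
    (q := (constFormAlg K n p).toSubmodule) fun _ hw => twist_mem_constFormAlg K 1 hw

theorem constParity_comp_self : constParity K n p ∘ₗ constParity K n p = LinearMap.id :=
  LinearMap.ext fun w => Subtype.ext (SuperPoly.twist_twist 1 (w : LocalForm K n p))

/-- On `Λ ⊗ N` the differential of the local forms is `σ ⊗ γ`, where the parity involution `σ` of
the constant forms is the sign of the Leibniz rule. -/
theorem gamma_formMul (z : constFormAlg K n p ⊗[K] LocalFun K n p) :
    gamma K (formMul K n p z) =
      formMul K n p (TensorProduct.map (constParity K n p) (gammaFun K) z) := by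
  induction z using TensorProduct.induction_on with
  | zero => simp
  | add y z hy hz => simp only [map_add, hy, hz]
  | tmul w f =>
    have h : gamma K ((w : LocalForm K n p) * toForm K f) = gamma K w * toForm K f +
        SuperPoly.twist K formDeg 1 w * gamma K (toForm K f) :=
      SuperPoly.der_mul 1 (gammaFormGen K) (hasShift_gammaFormGen K) _ _
    rw [formMul_tmul, h, gamma_of_mem_constFormAlg K w.2, zero_mul, zero_add, gamma_toForm]
    rfl

theorem map_constParity_gammaFun_rTensor (z : constFormAlg K n p ⊗[K] LocalFun K n p) :
    TensorProduct.map (constParity K n p) (gammaFun K)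
      ((constParity K n p).rTensor (LocalFun K n p) z) =
      (gammaFun K).lTensor (constFormAlg K n p) z := by
  rw [LinearMap.rTensor, ← LinearMap.comp_apply, ← TensorProduct.map_comp, constParity_comp_self]
  rfl

theorem rTensor_map_constParity_gammaFun (z : constFormAlg K n p ⊗[K] LocalFun K n p) :
    (constParity K n p).rTensor (LocalFun K n p)
      (TensorProduct.map (constParity K n p) (gammaFun K) z) =
      (gammaFun K).lTensor (constFormAlg K n p) z := by
  rw [LinearMap.rTensor, ← LinearMap.comp_apply, ← TensorProduct.map_comp, constParity_comp_self]
  rfl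

/-- `exists_mulHom_add_gammaFun` tensored with the constant forms: tensoring over a field preserves
exactness. -/
theorem exists_lTensor_add_lTensor [CharZero K] {z : constFormAlg K n p ⊗[K] LocalFun K n p}
    (hz : (gammaFun K).lTensor (constFormAlg K n p) z = 0) :
    ∃ y x, (mulHom K n p).toLinearMap.lTensor (constFormAlg K n p) y +
      (gammaFun K).lTensor (constFormAlg K n p) x = z := by
  have hex : Function.Exact ((mulHom K n p).toLinearMap.coprod (gammaFun K))
      (gammaFun K : LocalFun K n p →ₗ[K] LocalFun K n p) := by
    intro f
    constructor
    · intro hf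
      obtain ⟨y, x, h⟩ := exists_mulHom_add_gammaFun K hf
      exact ⟨(y, x), h⟩
    · rintro ⟨⟨y, x⟩, rfl⟩
      rw [LinearMap.coprod_apply, map_add, AlgHom.toLinearMap_apply, gammaFun_mulHom, zero_add]
      exact (funComplex K n p).d_d x
  obtain ⟨u, rfl⟩ := (Module.Flat.lTensor_exact (constFormAlg K n p)
    (N := (curvatureAlg K n p ⊗[K] lastGhostAlg K n p) × LocalFun K n p)
    (f := (mulHom K n p).toLinearMap.coprod (gammaFun K)) (g := gammaFun K) hex z).1 hz
  refine ⟨(LinearMap.fst K _ _).lTensor _ u, (LinearMap.snd K _ _).lTensor _ u, ?_⟩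
  rw [← LinearMap.comp_apply, ← LinearMap.comp_apply, ← LinearMap.lTensor_comp,
    ← LinearMap.lTensor_comp, ← LinearMap.add_apply, ← LinearMap.lTensor_add]
  rfl

/-- `eq_zero_of_gammaFun_eq_mulHom` tensored with the constant forms. -/
theorem eq_zero_of_lTensor_eq_lTensor [CharZero K] (hp : ∀ a, 1 ≤ p a)
    {y : constFormAlg K n p ⊗[K] (curvatureAlg K n p ⊗[K] lastGhostAlg K n p)}
    {x : constFormAlg K n p ⊗[K] LocalFun K n p}
    (h : (gammaFun K).lTensor (constFormAlg K n p) x =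
      (mulHom K n p).toLinearMap.lTensor (constFormAlg K n p) y) : y = 0 := by
  let q := (LinearMap.range (gammaFun K : LocalFun K n p →ₗ[K] LocalFun K n p)).mkQ
  have hq : Function.Injective (q ∘ₗ (mulHom K n p).toLinearMap) := by
    refine (injective_iff_map_eq_zero _).2 fun z hz => ?_
    obtain ⟨g, hg⟩ := (Submodule.Quotient.mk_eq_zero _).1 hz
    exact eq_zero_of_gammaFun_eq_mulHom K hp hg
  have hqg : q ∘ₗ gammaFun K = 0 := LinearMap.range_mkQ_comp _
  refine (injective_iff_map_eq_zero _).1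
    (Module.Flat.lTensor_preserves_injective_linearMap (M := constFormAlg K n p) _ hq) y ?_
  rw [LinearMap.lTensor_comp, LinearMap.comp_apply, ← h, ← LinearMap.comp_apply,
    ← LinearMap.lTensor_comp, hqg, LinearMap.lTensor_zero, LinearMap.zero_apply]

/-- The linear map `w ⊗ i ⊗ c ↦ w i c`. -/
def formMulHom (n : ℕ) {ι : Type*} (p : ι → ℕ) :
    constFormAlg K n p ⊗[K] (curvatureAlg K n p ⊗[K] lastGhostAlg K n p) →ₗ[K]
      LocalForm K n p :=
  formMul K n p ∘ₗ (mulHom K n p).toLinearMap.lTensor (constFormAlg K n p)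

theorem formMulHom_tmul (w : constFormAlg K n p) (i : curvatureAlg K n p)
    (c : lastGhostAlg K n p) : formMulHom K n p (w ⊗ₜ (i ⊗ₜ c)) =
      (w : LocalForm K n p) * toForm K ((i : LocalFun K n p) * (c : LocalFun K n p)) := by
  rw [← mulHom_tmul]
  rfl

theorem gamma_formMulHom
    (y : constFormAlg K n p ⊗[K] (curvatureAlg K n p ⊗[K] lastGhostAlg K n p)) :
    gamma K (formMulHom K n p y) = 0 := by
  have h : gammaFun K ∘ₗ (mulHom K n p).toLinearMap = 0 := LinearMap.ext (gammaFun_mulHom K)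
  rw [formMulHom, LinearMap.comp_apply, gamma_formMul, LinearMap.lTensor,
    ← LinearMap.comp_apply (TensorProduct.map _ _), ← TensorProduct.map_comp, h,
    TensorProduct.map_zero_right, LinearMap.zero_apply, map_zero]

theorem formClass_bijective [CharZero K] (hp : ∀ a, 1 ≤ p a) : Function.Bijective fun y =>
    (formComplex K n p).cls (formMulHom K n p y) (gamma_formMulHom K y) := by
  refine (formComplex K n p).cls_bijective
    (B := constFormAlg K n p ⊗[K] (curvatureAlg K n p ⊗[K] lastGhostAlg K n p))
    (formMulHom K n p) (gamma_formMulHom K) ?_ ?_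
  · intro y b h
    obtain ⟨z, rfl⟩ := formMul_surjective K b
    have h1 := formMul_injective K ((gamma_formMul K z).symm.trans h)
    refine eq_zero_of_lTensor_eq_lTensor K hp
      (x := (constParity K n p).rTensor (LocalFun K n p) z) (Eq.trans ?_ h1)
    rw [← map_constParity_gammaFun_rTensor, ← LinearMap.comp_apply (LinearMap.rTensor _ _),
      ← LinearMap.rTensor_comp, constParity_comp_self, LinearMap.rTensor_id, LinearMap.id_apply]
  · intro a ha
    obtain ⟨z, rfl⟩ := formMul_surjective K a
    have h1 : TensorProduct.map (constParity K n p) (gammaFun K) z = 0 := by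
      refine formMul_injective K (((gamma_formMul K z).symm.trans ha).trans (map_zero _).symm)
    have h2 : (gammaFun K).lTensor (constFormAlg K n p) z = 0 := by
      rw [← rTensor_map_constParity_gammaFun, h1, map_zero]
    obtain ⟨y, x, rfl⟩ := exists_lTensor_add_lTensor K h2
    refine ⟨y, formMul K n p ((constParity K n p).rTensor (LocalFun K n p) x), ?_⟩
    rw [map_add, ← map_constParity_gammaFun_rTensor, ← gamma_formMul]
    rfl

/-- The linear map `w ⊗ i ⊗ c ↦ [w i c]`. -/
def formClass (n : ℕ) {ι : Type*} (p : ι → ℕ) :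
    constFormAlg K n p ⊗[K] (curvatureAlg K n p ⊗[K] lastGhostAlg K n p) →ₗ[K]
      (formComplex K n p).Cohomology :=
  (Ideal.Quotient.mkₐ K (formComplex K n p).coboundaries).toLinearMap ∘ₗ
    (formMulHom K n p).codRestrict (Subalgebra.toSubmodule (formComplex K n p).cocycles)
      (gamma_formMulHom K)

/-- The sign comes from exchanging `c` and `w'`; the curvatures are even. -/
theorem mul_toForm_mul_mul_toForm (w : LocalForm K n p) {w' : LocalForm K n p}
    (i : LocalFun K n p) {i' : LocalFun K n p} {c : LocalFun K n p} (c' : LocalFun K n p)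
    {q g : ℕ} (hi : i ∈ curvatureAlg K n p) (hi' : i' ∈ curvatureAlg K n p)
    (hw' : SuperPoly.twist K formDeg 1 w' = ((-1 : K) ^ q) • w')
    (hc : SuperPoly.twist K Jet.ghost 1 c = ((-1 : K) ^ g) • c) :
    w * toForm K (i * c) * (w' * toForm K (i' * c')) =
      ((-1 : K) ^ (q * g)) • (w * w' * toForm K (i * i' * (c * c'))) := by
  have h1 : toForm K c * w' = ((-1 : K) ^ (q * g)) • (w' * toForm K c) := by
    rw [SuperPoly.mul_of_parity hw', SuperPoly.twist_of_parity (q := g)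
      (by rw [twist_toForm, hc, map_smul]), mul_smul_comm]
  have h2 : toForm K i * w' = w' * toForm K i :=
    SuperPoly.commute_of_even (by rw [twist_toForm, twist_of_mem_curvatureAlg K hi]) w'
  have h3 : c * i' = i' * c := (commute_of_mem_curvatureAlg K hi' c).symm
  calc w * toForm K (i * c) * (w' * toForm K (i' * c'))
      = w * (toForm K i * (toForm K c * w')) * toForm K (i' * c') := by
        simp only [map_mul, mul_assoc]
    _ = ((-1 : K) ^ (q * g)) • (w * (toForm K i * w') * toForm K (c * i' * c')) := by
        rw [h1]
        simp only [map_mul, mul_assoc, mul_smul_comm, smul_mul_assoc]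
    _ = _ := by
        rw [h2, h3]
        simp only [map_mul, mul_assoc]

end Forms

end

end PForm

theorem theorem3p1 {K : Type*} [Field K] [CharZero K] (n : ℕ) {ι : Type*} (p : ι → ℕ)
    (hp : ∀ a, 1 ≤ p a) :
    -- local functions: `H(γ) = I ⊗ C` as algebras, through `i ⊗ c ↦ [i c]`
    (∃ e : (PForm.curvatureAlg K n p ⊗[K] PForm.lastGhostAlg K n p) ≃ₐ[K]
          (PForm.funComplex K n p).Cohomology,
      ∀ (i : PForm.curvatureAlg K n p) (c : PForm.lastGhostAlg K n p),
        ∃ h : PForm.gammaFun K ((i : PForm.LocalFun K n p) * (c : PForm.LocalFun K n p)) = 0,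
          e (i ⊗ₜ[K] c) = (PForm.funComplex K n p).cls (i * c) h) ∧
    -- local forms: `H(γ) = Λ(dx) ⊗ I ⊗ C`, through `w ⊗ i ⊗ c ↦ [w i c]`, with the product of a
    -- tensor product of graded-commutative algebras
    (∃ e : (PForm.constFormAlg K n p ⊗[K]
          (PForm.curvatureAlg K n p ⊗[K] PForm.lastGhostAlg K n p)) ≃ₗ[K]
          (PForm.formComplex K n p).Cohomology,
      (∀ (w : PForm.constFormAlg K n p) (i : PForm.curvatureAlg K n p)
        (c : PForm.lastGhostAlg K n p),
        ∃ h : PForm.gamma K ((w : PForm.LocalForm K n p) *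
            PForm.toForm K ((i : PForm.LocalFun K n p) * (c : PForm.LocalFun K n p))) = 0,
          e (w ⊗ₜ[K] (i ⊗ₜ[K] c)) =
            (PForm.formComplex K n p).cls ((w : PForm.LocalForm K n p) *
              PForm.toForm K ((i : PForm.LocalFun K n p) * (c : PForm.LocalFun K n p))) h) ∧
      (∀ (w w' : PForm.constFormAlg K n p) (i i' : PForm.curvatureAlg K n p)
        (c c' : PForm.lastGhostAlg K n p) (q g : ℕ),
        (PForm.formComplex K n p).σ w' = ((-1 : K) ^ q) • (w' : PForm.LocalForm K n p) →
        (PForm.funComplex K n p).σ c = ((-1 : K) ^ g) • (c : PForm.LocalFun K n p) →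
          e (w ⊗ₜ[K] (i ⊗ₜ[K] c)) * e (w' ⊗ₜ[K] (i' ⊗ₜ[K] c')) =
            ((-1 : K) ^ (q * g)) • e ((w * w') ⊗ₜ[K] ((i * i') ⊗ₜ[K] (c * c'))))) := by
  refine ⟨⟨AlgEquiv.ofBijective (PForm.funClass K n p) (PForm.funClass_bijective K hp), ?_⟩,
    ⟨LinearEquiv.ofBijective (PForm.formClass K n p) (PForm.formClass_bijective K hp), ?_, ?_⟩⟩
  · intro i c
    have h := PForm.mulHom_tmul K i c
    exact ⟨h ▸ PForm.gammaFun_mulHom K (i ⊗ₜ c),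
      (PForm.funComplex K n p).cls_congr (PForm.gammaFun_mulHom K _) h⟩
  · intro w i c
    have h := PForm.formMulHom_tmul K w i c
    exact ⟨h ▸ PForm.gamma_formMulHom K (w ⊗ₜ (i ⊗ₜ c)),
      (PForm.formComplex K n p).cls_congr (PForm.gamma_formMulHom K _) h⟩
  · intro w w' i i' c c' q g hw' hc
    refine ((PForm.formComplex K n p).cls_congr ((PForm.formComplex K n p).cocycles.mul_mem
      (PForm.gamma_formMulHom K _) (PForm.gamma_formMulHom K _)) ?_).trans
      ((PForm.formComplex K n p).cls_smul _ (PForm.gamma_formMulHom K _)).symm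
    simp only [PForm.formMulHom_tmul]
    exact PForm.mul_toForm_mul_mul_toForm K _ _ _ i.2 i'.2 hw' hc
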